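/- Let $(M^n,g)$ be a connected smooth Riemannian $n$-manifold and let $\phi:M^n\to\mathbb E^{n+1}$ be a smooth isometric immersion into Euclidean space, i.e. a (possibly immersed) hypersurface. Let $\mathbf x^T$ denote the tangential part of the position vector field: the vector field on $M$ such that $\phi(p)-d\phi_p(\mathbf x^T_p)$ is normal to $d\phi_p(T_pM)$ for every $p\in M$. Suppose that $(M^n,g,\mathbf x^T,\lambda)$ is a Ricci soliton with $\lambda=1$, that is, $$\tfrac12\,\mathcal L_{\mathbf x^T}g+\mathrm{Ric}=g .$$ Then at least one of the following holds. 1. $M^n$ is totally umbilical: for every $p\in M$ there is a normal vector $H_p$ such that the second fundamental form satisfies $h(X,Y)=g(X,Y)H_p$ for all $X,Y\in T_pM$. 2. $(M^n,g)$ is flat and is generated by (pieces of) lines through the origin $o$: for every $p\in M$ there is a nonzero vector $v$ with $\phi(p)\in\mathbb R v$, an $\varepsilon>0$ and a continuous curve $\gamma:(-\varepsilon,\varepsilon)\to M$ with $\gamma(0)=p$ and $\phi(\gamma(t))=\phi(p)+tv$ for $|t|<\varepsilon$. 3. There is an integer $k$ with $2\le k\le n-1$ such that, up to a linear isometry of $\mathbb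 E^{n+1}$, $M^n$ is an open portion of the spherical hypercylinder $S^k(\sqrt{k-1})\times\mathbb E^{n-k}=\{(y,z)\in\mathbb E^{k+1}\times\mathbb E^{n-k}:\langle y,y\rangle=k-1\}$; that is, $\phi(M)$ is a relatively open subset of the image of this hypercylinder under a linear isometry. -/

import Mathlib

open scoped Manifold ContDiff

noncomputable section

namespace RicciSoliton

/-- Euclidean `m`-space with its standard inner product. -/
abbrev Euc (m : ℕ) : Type := EuclideanSpace ℝ (Fin m)

/-- The partial derivative `∂_i F` at `u` of a map `F` defined on (an open part of) `ℝⁿ`. -/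
def pd {n : ℕ} {V : Type*} [NormedAddCommGroup V] [NormedSpace ℝ V]
    (i : Fin n) (F : Euc n → V) (u : Euc n) : V :=
  fderiv ℝ F u (EuclideanSpace.single i 1)

/-! ### Riemannian geometry in local coordinates -/

section Local

variable {n : ℕ}

/-- The Christoffel symbols `Γᵏ_{ij} = ½ gᵏˡ (∂_i g_{jl} + ∂_j g_{il} - ∂_l g_{ij})` of the
Levi-Civita connection of a metric with components `g_{ij}`. -/
def christoffel (g : Euc n → Matrix (Fin n) (Fin n) ℝ) (k i j : Fin n) (u : Euc n) : ℝ :=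
  (1 / 2) * ∑ l, (g u)⁻¹ k l *
    (pd i (fun w => g w j l) u + pd j (fun w => g w i l) u - pd l (fun w => g w i j) u)

/-- The components of the curvature tensor `R(X,Y)Z = ∇_X ∇_Y Z - ∇_Y ∇_X Z - ∇_{[X,Y]} Z`:
`R(∂_i, ∂_j) ∂_k = ∑ l, curvature g l k i j • ∂_l`. -/
def curvature (g : Euc n → Matrix (Fin n) (Fin n) ℝ) (l k i j : Fin n) (u : Euc n) : ℝ :=
  pd i (christoffel g l j k) u - pd j (christoffel g l i k) u
    + ∑ m, (christoffel g l i m u * christoffel g m j k u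
      - christoffel g l j m u * christoffel g m i k u)

/-- The components of the Ricci tensor `Ric(Y,Z) = trace (X ↦ R(X,Y)Z)`. -/
def ricci (g : Euc n → Matrix (Fin n) (Fin n) ℝ) (j k : Fin n) (u : Euc n) : ℝ :=
  ∑ i, curvature g i k i j u

/-- The components of the Lie derivative
`(L_ξ g)_{ij} = ξᵏ ∂_k g_{ij} + g_{kj} ∂_i ξᵏ + g_{ik} ∂_j ξᵏ` of the metric. -/
def lieDerivMetric (ξ : Euc n → Euc n) (g : Euc n → Matrix (Fin n) (Fin n) ℝ)
    (i j : Fin n) (u : Euc n) : ℝ :=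
  ∑ k, (ξ u k * pd k (fun w => g w i j) u
    + g u k j * pd i (fun w => ξ w k) u + g u i k * pd j (fun w => ξ w k) u)

end Local

/-! ### Riemannian manifolds -/

section Manifold

variable {n : ℕ} {M : Type*} [TopologicalSpace M] [ChartedSpace (Euc n) M]

/-- The charts of the smooth structure of `M`. -/
abbrev charts (n : ℕ) (M : Type*) [TopologicalSpace M] [ChartedSpace (Euc n) M] :
    Set (OpenPartialHomeomorph M (Euc n)) :=
  IsManifold.maximalAtlas (𝓡 n) ∞ M

/-- The differential at `u` of the local parametrization `e.symm` inverse to a chart `e`. -/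
def dParam (e : OpenPartialHomeomorph M (Euc n)) (u : Euc n) :
    Euc n →L[ℝ] TangentSpace (𝓡 n) (e.symm u) :=
  mfderiv (𝓡 n) (𝓡 n) e.symm u

/-- The component functions on `e.target` of a vector field `ξ` on `M` in the chart `e`. -/
def coordField (ξ : (p : M) → TangentSpace (𝓡 n) p) (e : OpenPartialHomeomorph M (Euc n))
    (u : Euc n) : Euc n :=
  mfderiv (𝓡 n) (𝓡 n) e (e.symm u) (ξ (e.symm u))

variable [IsManifold (𝓡 n) ∞ M]

/-- Smooth Riemannian metrics on the manifold `M`. -/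
abbrev Metric (n : ℕ) (M : Type*) [TopologicalSpace M] [ChartedSpace (Euc n) M]
    [IsManifold (𝓡 n) ∞ M] :=
  Bundle.ContMDiffRiemannianMetric (𝓡 n) ∞ (Euc n) (fun p : M => TangentSpace (𝓡 n) p)

/-- The components `g_{ij} = g(∂_i, ∂_j)` on `e.target` of a metric in the chart `e`. -/
def coordMetric (g : Metric n M) (e : OpenPartialHomeomorph M (Euc n)) (u : Euc n) :
    Matrix (Fin n) (Fin n) ℝ :=
  Matrix.of fun i j => g.inner (e.symm u) (dParam e u (EuclideanSpace.single i 1))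
    (dParam e u (EuclideanSpace.single j 1))

/-- `(M, g, ξ, lam)` is a Ricci soliton: `½ L_ξ g + Ric = lam g`, as an identity of tensors, that
is, of their components in every chart. -/
def IsRicciSoliton (g : Metric n M) (ξ : (p : M) → TangentSpace (𝓡 n) p) (lam : ℝ) : Prop :=
  ∀ e ∈ charts n M, ∀ u ∈ e.target, ∀ i j : Fin n,
    (1 / 2) * lieDerivMetric (coordField ξ e) (coordMetric g e) i j u
      + ricci (coordMetric g e) i j u = lam * coordMetric g e u i j

/-- `(M, g)` is flat: its curvature tensor vanishes identically. -/
def IsFlat (g : Metric n M) : Prop :=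
  ∀ e ∈ charts n M, ∀ u ∈ e.target, ∀ i j k l : Fin n, curvature (coordMetric g e) l k i j u = 0

end Manifold

/-! ### Submanifolds of Euclidean space -/

section Submanifold

variable {n m : ℕ} {M : Type*} [TopologicalSpace M] [ChartedSpace (Euc n) M]

/-- The differential `dφ_p : T_pM → 𝔼ᵐ`. -/
def differential (n : ℕ) {m : ℕ} {M : Type*} [TopologicalSpace M]
    [ChartedSpace (Euc n) M] (φ : M → Euc m) (p : M) : TangentSpace (𝓡 n) p →L[ℝ] Euc m :=
  mfderiv (𝓡 n) (𝓡 m) φ p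

/-- The tangent space of the immersed submanifold at `p`, as a subspace of `𝔼ᵐ`. -/
def tangentPlane (n : ℕ) {m : ℕ} {M : Type*} [TopologicalSpace M]
    [ChartedSpace (Euc n) M] (φ : M → Euc m) (p : M) : Submodule ℝ (Euc m) :=
  LinearMap.range (differential n φ p).toLinearMap

/-- `ξ` is the tangential part `xᵀ` of the position vector field `x` along `φ`: the vector
`x - dφ(ξ)` is normal at every point. -/
def IsTangentialPosition (φ : M → Euc m) (ξ : (p : M) → TangentSpace (𝓡 n) p) : Prop :=
  ∀ p, φ p - differential n φ p (ξ p) ∈ (tangentPlane n φ p)ᗮ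

/-- The components `h(∂_i, ∂_j)` of the second fundamental form of `φ` in the chart `e`: the normal
part of the derivative of `∂_j` in the direction `∂_i`. -/
def secondFundForm (φ : M → Euc m) (e : OpenPartialHomeomorph M (Euc n)) (i j : Fin n)
    (u : Euc n) : Euc m :=
  (tangentPlane n φ (e.symm u))ᗮ.starProjection (pd i (pd j (fun w => φ (e.symm w))) u)

/-- Every point of the immersed submanifold is interior to a straight segment in it that is part of
a line through the origin. -/
def IsRuledByLinesThroughOrigin (φ : M → Euc m) : Prop :=
  ∀ p : M, ∃ v : Euc m, v ≠ 0 ∧ φ p ∈ Submodule.span ℝ {v} ∧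
    ∃ ε : ℝ, 0 < ε ∧ ∃ γ : ℝ → M, ContinuousOn γ (Set.Ioo (-ε) ε) ∧ γ 0 = p ∧
      ∀ t ∈ Set.Ioo (-ε) ε, φ (γ t) = φ p + t • v

variable [IsManifold (𝓡 n) ∞ M]

/-- `φ` is a (smooth) isometric immersion of `(M, g)`. -/
def IsIsometricImmersion (g : Metric n M) (φ : M → Euc m) : Prop :=
  ContMDiff (𝓡 n) (𝓡 m) ∞ φ ∧
    ∀ (p : M) (v w : TangentSpace (𝓡 n) p),
      g.inner p v w = inner ℝ (differential n φ p v) (differential n φ p w)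

/-- `φ` is totally umbilical: at every point there is a normal vector `H` with
`h(X, Y) = g(X, Y) H` for all tangent `X, Y`. -/
def IsTotallyUmbilical (g : Metric n M) (φ : M → Euc m) : Prop :=
  ∀ e ∈ charts n M, ∀ u ∈ e.target, ∃ H ∈ (tangentPlane n φ (e.symm u))ᗮ,
    ∀ i j : Fin n, secondFundForm φ e i j u = coordMetric g e u i j • H

/-- The spherical hypercylinder `Sᵏ(√(k-1)) × 𝔼ⁿ⁻ᵏ` in `𝔼ⁿ⁺¹`: the points `(y, z)` with
`y ∈ 𝔼ᵏ⁺¹`, `z ∈ 𝔼ⁿ⁻ᵏ` and `‖y‖² = k - 1`. -/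
def sphericalHypercylinder (n k : ℕ) : Set (Euc (n + 1)) :=
  {x | ∑ i with i.val < k + 1, x i ^ 2 = (k : ℝ) - 1}

end Submanifold

end RicciSoliton

end

/-!
The soliton equation is reduced to an algebraic condition on the shape operator `S` and then
integrated. In a chart the manifold is a patch `ψ` with unit normal `ν`; write `ρ = ⟨ψ, ν⟩` for the
support function. The Lie derivative of the metric along the tangential part of the position vector
is `2 (g + ρ h)` (`IsPatch.lieDerivMetric_eq`), and the Gauss equation (`IsPatch.gauss`) computes
the Ricci tensor, so that the soliton equation with constant `1` becomes `S² = κ S` with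
`κ = tr S + ρ` (`IsPatch.shapeOp_sq`). Where `S ≠ 0`, the operator `Q = κ⁻¹ S` is therefore an
orthogonal projection; its rank `k` is locally constant and `ρ = (1 - k) κ`.

If `k ≥ 2`, the Codazzi equation along the image of `Q` and `dρ = -⟨ψ, S ·⟩` along its kernel show
that `κ` is locally constant. Hence `Q ψ = 0`, and differentiating this gives `(k - 1) κ² = 1`
(`IsPatch.principalCurv_sq`). Moreover the projection `Q + ν ⊗ ν` is locally constant
(`IsPatch.fderiv_cylinderProj`): the tangential part of the derivative of `Q` is a symmetric
trilinear form, and it vanishes when its last two arguments lie both in the image or both in the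
kernel of `Q`. So `ψ` lies on the cylinder `‖(Q + ν ⊗ ν) x‖² = k - 1`.

To pass from charts to the manifold, these data are recorded in `nullity φ p`, the common kernel of
the derivatives of the tangential projection, which involves no choice of normal. Its codimension
determines `k`; the set of points of a given multiplicity `k ≥ 2` is open, and closed because
`(k - 1) κ² = 1` and `tr S = k κ` are closed conditions that exclude `S = 0` (`isClopen_mult`). If
this set is not empty, it is all of `M`, which is then totally umbilical (`k = n`) or an open part
of one fixed cylinder.

In the remaining case `S` has rank at most one. Then `M` is flat by the Gauss equation, and `ρ²` is
constant, as `ρ = 0` where the rank is one and `dρ = 0` where `S = 0`. So either `S = 0` everywhere,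
or `ρ = 0` everywhere and the position vector is tangent. In the second case `M` is locally the
graph of a map `F` over a tangent space that satisfies Euler's relation `dF_y y = F y`, so it
contains segments of lines through the origin (`IsPatch.exists_segment`); this argument also covers
a point of `M` that is mapped to the origin.
-/

noncomputable section

namespace RicciSoliton

/-! ### Hypersurface patches, coframes and shape operators -/

/-- A parametrized hypersurface patch: an immersion `ψ` of an open set `U ⊆ ℝⁿ` into `𝔼ⁿ⁺¹` together
with a smooth field `ν` of unit normals. -/
structure IsPatch {n : ℕ} (U : Set (Euc n)) (ψ ν : Euc n → Euc (n + 1)) : Prop where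
  isOpen : IsOpen U
  smooth : ContDiffOn ℝ ∞ ψ U
  smooth_normal : ContDiffOn ℝ ∞ ν U
  injective : ∀ u ∈ U, Function.Injective (fderiv ℝ ψ u)
  norm_normal : ∀ u ∈ U, ‖ν u‖ = 1
  normal : ∀ u ∈ U, ∀ v, inner ℝ (fderiv ℝ ψ u v) (ν u) = 0

section Frame

variable {n : ℕ} (ψ ν : Euc n → Euc (n + 1))

/-- The isomorphism `ℝⁿ × ℝ → 𝔼ⁿ⁺¹`, `(v, s) ↦ dψ v + s ν`. -/
def frameMap (u : Euc n) : (Euc n × ℝ) →L[ℝ] Euc (n + 1) :=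
  (fderiv ℝ ψ u).coprod (ContinuousLinearMap.toSpanSingleton ℝ (ν u))

/-- The left inverse of `dψ` with kernel spanned by the normal. -/
def coframe (u : Euc n) : Euc (n + 1) →L[ℝ] Euc n :=
  ContinuousLinearMap.fst ℝ (Euc n) ℝ ∘L (frameMap ψ ν u).inverse

/-- The shape operator, as an operator on the ambient space: it maps `dψ v` to `-dν v` and kills
the normal. -/
def shapeOp (u : Euc n) : Euc (n + 1) →L[ℝ] Euc (n + 1) :=
  -(fderiv ℝ ν u ∘L coframe ψ ν u)

/-- The support function `⟨x, ν⟩`. -/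
def support (u : Euc n) : ℝ := inner ℝ (ψ u) (ν u)

end Frame

/-- The trace of an operator on `𝔼ᵐ`, as a continuous linear functional. -/
def traceCLM (m : ℕ) : (Euc m →L[ℝ] Euc m) →L[ℝ] ℝ :=
  LinearMap.toContinuousLinearMap
    (LinearMap.trace ℝ (Euc m) ∘ₗ ContinuousLinearMap.coeLM ℝ)

lemma traceCLM_apply {m : ℕ} (T : Euc m →L[ℝ] Euc m) :
    traceCLM m T = LinearMap.trace ℝ (Euc m) T.toLinearMap := rfl

lemma contDiffAt_fderiv {E F : Type*} [NormedAddCommGroup E] [NormedSpace ℝ E]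
    [NormedAddCommGroup F] [NormedSpace ℝ F] {f : E → F} {x : E} (hf : ContDiffAt ℝ ∞ f x) :
    ContDiffAt ℝ ∞ (fderiv ℝ f) x :=
  hf.fderiv_right (by simp)

lemma contDiffAt_pd {n : ℕ} {V : Type*} [NormedAddCommGroup V] [NormedSpace ℝ V] {f : Euc n → V}
    {u : Euc n} (hf : ContDiffAt ℝ ∞ f u) (i : Fin n) : ContDiffAt ℝ ∞ (pd i f) u :=
  (contDiffAt_fderiv hf).clm_apply contDiffAt_const

lemma fderiv_fderiv_comm {E F : Type*} [NormedAddCommGroup E] [NormedSpace ℝ E]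
    [NormedAddCommGroup F] [NormedSpace ℝ F] {f : E → F} {x : E} (hf : ContDiffAt ℝ ∞ f x)
    (v w : E) : fderiv ℝ (fderiv ℝ f) x v w = fderiv ℝ (fderiv ℝ f) x w v :=
  (hf.isSymmSndFDerivAt (by simp; exact WithTop.coe_le_coe.2 le_top)).eq v w

namespace IsPatch

variable {n : ℕ} {U : Set (Euc n)} {ψ ν : Euc n → Euc (n + 1)} (hP : IsPatch U ψ ν) {u : Euc n}
include hP

lemma contDiffAt (hu : u ∈ U) : ContDiffAt ℝ ∞ ψ u :=
  hP.smooth.contDiffAt (hP.isOpen.mem_nhds hu)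

lemma contDiffAt_normal (hu : u ∈ U) : ContDiffAt ℝ ∞ ν u :=
  hP.smooth_normal.contDiffAt (hP.isOpen.mem_nhds hu)

lemma eventually_mem (hu : u ∈ U) : ∀ᶠ w in nhds u, w ∈ U := hP.isOpen.mem_nhds hu

lemma inner_normal_self (hu : u ∈ U) : inner ℝ (ν u) (ν u) = (1 : ℝ) := by
  rw [real_inner_self_eq_norm_sq, hP.norm_normal u hu]; norm_num

lemma frameMap_isInvertible (hu : u ∈ U) : (frameMap ψ ν u).IsInvertible := by
  have hinj : Function.Injective (frameMap ψ ν u).toLinearMap := by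
    rw [← LinearMap.ker_eq_bot, LinearMap.ker_eq_bot']
    rintro ⟨v, s⟩ h
    have h' : fderiv ℝ ψ u v + s • ν u = 0 := by simpa [frameMap] using h
    have hs : s = 0 := by
      have := congrArg (fun w => inner ℝ w (ν u)) h'
      rw [inner_add_left, hP.normal u hu, inner_smul_left, hP.inner_normal_self hu] at this
      simpa using this
    subst hs
    have hv : v = 0 := hP.injective u hu (by simpa using h')
    simp [hv]
  let e := (LinearMap.linearEquivOfInjective _ hinj (by simp)).toContinuousLinearEquiv
  exact ⟨e, by ext <;> rfl⟩

lemma frameMap_inverse (hu : u ∈ U) (v : Euc n) (s : ℝ) :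
    (frameMap ψ ν u).inverse (fderiv ℝ ψ u v + s • ν u) = (v, s) := by
  rw [(hP.frameMap_isInvertible hu).inverse_apply_eq]
  simp [frameMap]

lemma coframe_fderiv (hu : u ∈ U) (v : Euc n) : coframe ψ ν u (fderiv ℝ ψ u v) = v := by
  have := hP.frameMap_inverse hu v 0
  simp only [zero_smul, add_zero] at this
  simp [coframe, this]

lemma coframe_normal (hu : u ∈ U) : coframe ψ ν u (ν u) = 0 := by
  have := hP.frameMap_inverse hu 0 1
  simp only [map_zero, one_smul, zero_add] at this
  simp [coframe, this]

/-- Every ambient vector is the sum of its tangential and normal parts. -/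
lemma decomp (hu : u ∈ U) (w : Euc (n + 1)) :
    w = fderiv ℝ ψ u (coframe ψ ν u w) + inner ℝ w (ν u) • ν u := by
  obtain ⟨⟨v, s⟩, rfl⟩ := (hP.frameMap_isInvertible hu).bijective.2 w
  have h : frameMap ψ ν u (v, s) = fderiv ℝ ψ u v + s • ν u := by simp [frameMap]
  rw [h, map_add, map_smul, hP.coframe_fderiv hu, hP.coframe_normal hu, inner_add_left,
    hP.normal u hu, inner_smul_left, hP.inner_normal_self hu]
  simp

lemma contDiffAt_coframe (hu : u ∈ U) : ContDiffAt ℝ ∞ (coframe ψ ν) u := by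
  have h1 : ContDiffAt ℝ ∞ (frameMap ψ ν) u := by
    have ha := contDiffAt_fderiv (hP.contDiffAt hu)
    have hb := hP.contDiffAt_normal hu
    have h : frameMap ψ ν = fun u => fderiv ℝ ψ u ∘L ContinuousLinearMap.fst ℝ (Euc n) ℝ +
        (ContinuousLinearMap.toSpanSingletonCLE (𝕜 := ℝ) (ν u)) ∘L
          ContinuousLinearMap.snd ℝ (Euc n) ℝ := by
      funext u
      ext <;> simp [frameMap]
    rw [h]
    have hc : ContDiffAt ℝ ∞
        (fun u => ContinuousLinearMap.toSpanSingletonCLE (𝕜 := ℝ) (ν u)) u :=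
      (ContinuousLinearEquiv.contDiff _).contDiffAt.comp u hb
    exact (ha.clm_comp contDiffAt_const).add (hc.clm_comp contDiffAt_const)
  exact contDiffAt_const.clm_comp
    (((hP.frameMap_isInvertible hu).contDiffAt_map_inverse).comp u h1)

lemma contDiffAt_shapeOp (hu : u ∈ U) : ContDiffAt ℝ ∞ (shapeOp ψ ν) u :=
  ((contDiffAt_fderiv (hP.contDiffAt_normal hu)).clm_comp (hP.contDiffAt_coframe hu)).neg

lemma contDiffAt_support (hu : u ∈ U) : ContDiffAt ℝ ∞ (support ψ ν) u :=
  (hP.contDiffAt hu).inner ℝ (hP.contDiffAt_normal hu)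

lemma shapeOp_fderiv (hu : u ∈ U) (v : Euc n) :
    shapeOp ψ ν u (fderiv ℝ ψ u v) = -fderiv ℝ ν u v := by
  simp [shapeOp, hP.coframe_fderiv hu]

lemma fderiv_normal (hu : u ∈ U) (v : Euc n) :
    fderiv ℝ ν u v = -shapeOp ψ ν u (fderiv ℝ ψ u v) := by
  rw [hP.shapeOp_fderiv hu, neg_neg]

lemma shapeOp_normal (hu : u ∈ U) : shapeOp ψ ν u (ν u) = 0 := by
  simp [shapeOp, hP.coframe_normal hu]

lemma inner_fderiv_normal (hu : u ∈ U) (v : Euc n) : inner ℝ (fderiv ℝ ν u v) (ν u) = (0 : ℝ) := by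
  have hd := (hP.contDiffAt_normal hu).differentiableAt (by simp)
  have h : (fun w => inner ℝ (ν w) (ν w)) =ᶠ[nhds u] fun _ => (1 : ℝ) := by
    filter_upwards [hP.eventually_mem hu] with w hw using hP.inner_normal_self hw
  have h1 := congrArg (fun L : Euc n →L[ℝ] ℝ => L v) h.fderiv_eq
  simp only [fderiv_inner_apply ℝ hd hd, fderiv_fun_const] at h1
  rw [real_inner_comm (fderiv ℝ ν u v)] at h1
  have : (0 : Euc n → Euc n →L[ℝ] ℝ) u v = 0 := rfl
  linarith

lemma inner_shapeOp_normal (hu : u ∈ U) (w : Euc (n + 1)) :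
    inner ℝ (shapeOp ψ ν u w) (ν u) = (0 : ℝ) := by
  simp [shapeOp, inner_neg_left, hP.inner_fderiv_normal hu]

lemma inner_normal_shapeOp (hu : u ∈ U) (w : Euc (n + 1)) :
    inner ℝ (ν u) (shapeOp ψ ν u w) = (0 : ℝ) := by
  rw [real_inner_comm, hP.inner_shapeOp_normal hu]

/-- The scalar second fundamental form is `⟨S dψ v, dψ w⟩`. -/
lemma inner_snd_fderiv_normal (hu : u ∈ U) (v w : Euc n) :
    inner ℝ (fderiv ℝ (fderiv ℝ ψ) u v w) (ν u) =
      inner ℝ (shapeOp ψ ν u (fderiv ℝ ψ u v)) (fderiv ℝ ψ u w) := by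
  have hd := (hP.contDiffAt_normal hu).differentiableAt (by simp)
  have hd' := (contDiffAt_fderiv (hP.contDiffAt hu)).differentiableAt (by simp)
  have h : (fun x => inner ℝ (fderiv ℝ ψ x w) (ν x)) =ᶠ[nhds u] fun _ => (0 : ℝ) := by
    filter_upwards [hP.eventually_mem hu] with x hx using hP.normal x hx w
  have h1 := congrArg (fun L : Euc n →L[ℝ] ℝ => L v) h.fderiv_eq
  rw [fderiv_inner_apply ℝ (hd'.clm_apply (differentiableAt_const w)) hd,
    fderiv_clm_apply hd' (differentiableAt_const w)] at h1
  simp only [fderiv_fun_const, Pi.zero_apply, ContinuousLinearMap.comp_zero, zero_add,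
    ContinuousLinearMap.flip_apply, zero_apply] at h1
  rw [hP.shapeOp_fderiv hu, inner_neg_left, real_inner_comm (fderiv ℝ ψ u w)]
  linarith

lemma inner_shapeOp_fderiv_comm (hu : u ∈ U) (v w : Euc n) :
    inner ℝ (shapeOp ψ ν u (fderiv ℝ ψ u v)) (fderiv ℝ ψ u w) =
      inner ℝ (fderiv ℝ ψ u v) (shapeOp ψ ν u (fderiv ℝ ψ u w)) := by
  rw [← hP.inner_snd_fderiv_normal hu, fderiv_fderiv_comm (hP.contDiffAt hu),
    hP.inner_snd_fderiv_normal hu, real_inner_comm]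

lemma shapeOp_symm (hu : u ∈ U) (x y : Euc (n + 1)) :
    inner ℝ (shapeOp ψ ν u x) y = inner ℝ x (shapeOp ψ ν u y) := by
  have hx : shapeOp ψ ν u x = shapeOp ψ ν u (fderiv ℝ ψ u (coframe ψ ν u x)) := by
    conv_lhs => rw [hP.decomp hu x]
    simp [hP.shapeOp_normal hu]
  have hy : shapeOp ψ ν u y = shapeOp ψ ν u (fderiv ℝ ψ u (coframe ψ ν u y)) := by
    conv_lhs => rw [hP.decomp hu y]
    simp [hP.shapeOp_normal hu]
  calc inner ℝ (shapeOp ψ ν u x) y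
      = inner ℝ (shapeOp ψ ν u x) (fderiv ℝ ψ u (coframe ψ ν u y)) := by
        conv_lhs => rw [hP.decomp hu y]
        simp [inner_add_right, inner_smul_right, hP.inner_shapeOp_normal hu]
    _ = inner ℝ (fderiv ℝ ψ u (coframe ψ ν u x)) (shapeOp ψ ν u y) := by
        rw [hx, hP.inner_shapeOp_fderiv_comm hu, hy]
    _ = inner ℝ x (shapeOp ψ ν u y) := by
        conv_rhs => rw [hP.decomp hu x]
        simp [inner_add_left, inner_smul_left, hP.inner_normal_shapeOp hu]

/-- The Codazzi equation; it expresses the symmetry of the second derivative of `ν`. -/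
lemma codazzi (hu : u ∈ U) (v w : Euc n) :
    fderiv ℝ (shapeOp ψ ν) u v (fderiv ℝ ψ u w) = fderiv ℝ (shapeOp ψ ν) u w (fderiv ℝ ψ u v) := by
  have hS := (hP.contDiffAt_shapeOp hu).differentiableAt (by simp)
  have hd' := (contDiffAt_fderiv (hP.contDiffAt hu)).differentiableAt (by simp)
  have hν := (contDiffAt_fderiv (hP.contDiffAt_normal hu)).differentiableAt (by simp)
  have key : ∀ a b, fderiv ℝ (shapeOp ψ ν) u a (fderiv ℝ ψ u b) =
      -fderiv ℝ (fderiv ℝ ν) u a b - shapeOp ψ ν u (fderiv ℝ (fderiv ℝ ψ) u a b) := by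
    intro a b
    have h : (fun x => shapeOp ψ ν x (fderiv ℝ ψ x b)) =ᶠ[nhds u] fun x => -(fderiv ℝ ν x b) := by
      filter_upwards [hP.eventually_mem hu] with x hx using hP.shapeOp_fderiv hx b
    have h1 := congrArg (fun L : Euc n →L[ℝ] Euc (n + 1) => L a) h.fderiv_eq
    rw [fderiv_clm_apply hS (hd'.clm_apply (differentiableAt_const b)), fderiv_fun_neg,
      fderiv_clm_apply hd' (differentiableAt_const b),
      fderiv_clm_apply hν (differentiableAt_const b)] at h1
    simp only [fderiv_fun_const, Pi.zero_apply, ContinuousLinearMap.comp_zero, zero_add,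
      ContinuousLinearMap.flip_apply, add_apply, ContinuousLinearMap.comp_apply,
      neg_apply] at h1
    rw [← h1]; abel
  rw [key, key, fderiv_fderiv_comm (hP.contDiffAt hu), fderiv_fderiv_comm (hP.contDiffAt_normal hu)]

lemma fderiv_support (hu : u ∈ U) (v : Euc n) :
    fderiv ℝ (support ψ ν) u v = -inner ℝ (ψ u) (shapeOp ψ ν u (fderiv ℝ ψ u v)) := by
  have hd := (hP.contDiffAt_normal hu).differentiableAt (by simp)
  have hd' := (hP.contDiffAt hu).differentiableAt (by simp)
  unfold support
  rw [fderiv_inner_apply ℝ hd' hd, hP.normal u hu, hP.fderiv_normal hu, inner_neg_right, add_zero]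

end IsPatch

/-! ### The Gauss equation and the soliton equation of a patch -/

lemma clm_apply_eq_sum {n : ℕ} {V : Type*} [NormedAddCommGroup V] [NormedSpace ℝ V]
    (L : Euc n →L[ℝ] V) (v : Euc n) : L v = ∑ k, v k • L (EuclideanSpace.single k 1) := by
  conv_lhs => rw [← (EuclideanSpace.basisFun (Fin n) ℝ).sum_repr v]
  simp

lemma pd_apply_coord {n m : ℕ} {F : Euc n → Euc m} {u : Euc n} (hF : DifferentiableAt ℝ F u)
    (i : Fin n) (k : Fin m) : pd i (fun w => F w k) u = pd i F u k := by
  have h : HasFDerivAt (fun w => F w k) ((EuclideanSpace.proj k : Euc m →L[ℝ] ℝ) ∘L fderiv ℝ F u) u :=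
    (EuclideanSpace.proj k : Euc m →L[ℝ] ℝ).hasFDerivAt.comp u hF.hasFDerivAt
  simp [pd, h.fderiv]

lemma pd_inner {n m : ℕ} {F G : Euc n → Euc m} {u : Euc n} (hF : DifferentiableAt ℝ F u)
    (hG : DifferentiableAt ℝ G u) (i : Fin n) :
    pd i (fun w => (inner ℝ (F w) (G w) : ℝ)) u
      = inner ℝ (F u) (pd i G u) + inner ℝ (pd i F u) (G u) :=
  fderiv_inner_apply ℝ hF hG _

lemma pd_congr {n : ℕ} {V : Type*} [NormedAddCommGroup V] [NormedSpace ℝ V] {F G : Euc n → V}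
    {u : Euc n} (h : F =ᶠ[nhds u] G) (i : Fin n) : pd i F u = pd i G u := by
  simp [pd, h.fderiv_eq]

lemma pd_pd {n : ℕ} {V : Type*} [NormedAddCommGroup V] [NormedSpace ℝ V] {F : Euc n → V}
    {u : Euc n} (hF : ContDiffAt ℝ ∞ F u) (i j : Fin n) :
    pd i (pd j F) u =
      fderiv ℝ (fderiv ℝ F) u (EuclideanSpace.single i 1) (EuclideanSpace.single j 1) := by
  have hd' := (contDiffAt_fderiv hF).differentiableAt (by simp)
  unfold pd
  rw [fderiv_clm_apply hd' (differentiableAt_const _)]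
  simp

lemma pd_comm {n : ℕ} {V : Type*} [NormedAddCommGroup V] [NormedSpace ℝ V] {F : Euc n → V}
    {u : Euc n} (hF : ContDiffAt ℝ ∞ F u) (i j : Fin n) : pd i (pd j F) u = pd j (pd i F) u := by
  rw [pd_pd hF, pd_pd hF, fderiv_fderiv_comm hF]

/-- The scalar second fundamental form `h_{ij} = ⟨S ∂_i, ∂_j⟩` of a patch. -/
def sff {n : ℕ} (ψ ν : Euc n → Euc (n + 1)) (i j : Fin n) (u : Euc n) : ℝ :=
  inner ℝ (shapeOp ψ ν u (pd i ψ u)) (pd j ψ u)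

/-- `g` is the matrix of the metric induced on `U` by `ψ`. -/
def IsInducedMetric {n : ℕ} (U : Set (Euc n)) (ψ : Euc n → Euc (n + 1))
    (g : Euc n → Matrix (Fin n) (Fin n) ℝ) : Prop :=
  ∀ u ∈ U, ∀ i j, g u i j = inner ℝ (pd i ψ u) (pd j ψ u)

namespace IsPatch

variable {n : ℕ} {U : Set (Euc n)} {ψ ν : Euc n → Euc (n + 1)} (hP : IsPatch U ψ ν) {u : Euc n}
  {g : Euc n → Matrix (Fin n) (Fin n) ℝ}
include hP

lemma isUnit_metric (hg : IsInducedMetric U ψ g) (hu : u ∈ U) : IsUnit (g u) := by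
  rw [← Matrix.mulVec_injective_iff_isUnit]
  change Function.Injective (Matrix.mulVecLin (g u))
  rw [injective_iff_map_eq_zero]
  intro v hv
  let v' : Euc n := WithLp.toLp 2 v
  have hsum : fderiv ℝ ψ u v' = ∑ k, v k • pd k ψ u := clm_apply_eq_sum _ _
  have h0 : ∀ i, inner ℝ (pd i ψ u) (fderiv ℝ ψ u v') = (0 : ℝ) := by
    intro i
    have := congrFun hv i
    simp only [Matrix.mulVecLin_apply, Matrix.mulVec, dotProduct, Pi.zero_apply] at this
    rw [hsum, inner_sum, ← this]
    exact Finset.sum_congr rfl fun k _ => by rw [hg u hu, inner_smul_right, mul_comm]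
  have h1 : inner ℝ (fderiv ℝ ψ u v') (fderiv ℝ ψ u v') = (0 : ℝ) := by
    conv_lhs => enter [2]; rw [hsum]
    rw [sum_inner]
    exact Finset.sum_eq_zero fun k _ => by rw [inner_smul_left, h0, mul_zero]
  have h2 : v' = 0 := hP.injective u hu (by rw [inner_self_eq_zero.1 h1, map_zero])
  exact congrArg WithLp.ofLp h2

/-- The inverse of the metric computes tangential coordinates. -/
lemma sum_inv_mul_inner (hg : IsInducedMetric U ψ g) (hu : u ∈ U) (w : Euc (n + 1)) (k : Fin n) :
    ∑ l, (g u)⁻¹ k l * inner ℝ w (pd l ψ u) = coframe ψ ν u w k := by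
  have h1 : (fun l => (inner ℝ w (pd l ψ u) : ℝ)) = (g u).mulVec (coframe ψ ν u w).ofLp := by
    funext l
    conv_lhs => rw [hP.decomp hu w]
    have : (inner ℝ (ν u) (pd l ψ u) : ℝ) = 0 := by
      rw [real_inner_comm]; exact hP.normal u hu _
    rw [inner_add_left, inner_smul_left, this, clm_apply_eq_sum, sum_inner, mul_zero, add_zero]
    refine Finset.sum_congr rfl fun m _ => ?_
    change _ = g u l m * _
    rw [hg u hu, inner_smul_left, real_inner_comm, mul_comm]
    simp [pd]
  have h2 := congrFun (congrArg ((g u)⁻¹).mulVec h1) k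
  rw [Matrix.mulVec_mulVec, Matrix.nonsing_inv_mul _
    ((Matrix.isUnit_iff_isUnit_det _).1 (hP.isUnit_metric hg hu)), Matrix.one_mulVec] at h2
  exact h2

lemma pd_metric (hg : IsInducedMetric U ψ g) (hu : u ∈ U) (i j l : Fin n) :
    pd i (fun w => g w j l) u =
      inner ℝ (pd j ψ u) (pd i (pd l ψ) u) + inner ℝ (pd i (pd j ψ) u) (pd l ψ u) := by
  have h : (fun w => g w j l) =ᶠ[nhds u] fun w => inner ℝ (pd j ψ w) (pd l ψ w) := by
    filter_upwards [hP.eventually_mem hu] with w hw using hg w hw j l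
  rw [pd_congr h, pd_inner ((contDiffAt_pd (hP.contDiffAt hu) j).differentiableAt (by simp))
    ((contDiffAt_pd (hP.contDiffAt hu) l).differentiableAt (by simp))]

/-- The Christoffel symbols are the tangential coordinates of the second derivatives. -/
lemma christoffel_eq (hg : IsInducedMetric U ψ g) (hu : u ∈ U) (k i j : Fin n) :
    christoffel g k i j u = coframe ψ ν u (pd i (pd j ψ) u) k := by
  rw [christoffel, ← hP.sum_inv_mul_inner hg hu, Finset.mul_sum]
  refine Finset.sum_congr rfl fun l _ => ?_
  have hψ := hP.contDiffAt hu
  rw [hP.pd_metric hg hu, hP.pd_metric hg hu, hP.pd_metric hg hu, pd_comm hψ j i, pd_comm hψ l i,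
    pd_comm hψ l j, real_inner_comm (pd j ψ u)]
  ring

lemma pd_pd_eq (hu : u ∈ U) (i j : Fin n) :
    pd i (pd j ψ) u = fderiv ℝ ψ u (coframe ψ ν u (pd i (pd j ψ) u)) + sff ψ ν i j u • ν u := by
  conv_lhs => rw [hP.decomp hu (pd i (pd j ψ) u)]
  congr 2
  rw [pd_pd (hP.contDiffAt hu), hP.inner_snd_fderiv_normal hu]
  rfl

lemma contDiffAt_sff (hu : u ∈ U) (i j : Fin n) : ContDiffAt ℝ ∞ (sff ψ ν i j) u :=
  ((hP.contDiffAt_shapeOp hu).clm_apply (contDiffAt_pd (hP.contDiffAt hu) i)).inner ℝ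
    (contDiffAt_pd (hP.contDiffAt hu) j)

lemma sff_comm (hu : u ∈ U) (i j : Fin n) : sff ψ ν i j u = sff ψ ν j i u := by
  rw [sff, hP.shapeOp_symm hu, real_inner_comm, sff]

/-- The Gauss equation. -/
lemma gauss (hg : IsInducedMetric U ψ g) (hu : u ∈ U) (l k i j : Fin n) :
    curvature g l k i j u =
      sff ψ ν j k u * coframe ψ ν u (shapeOp ψ ν u (pd i ψ u)) l
        - sff ψ ν i k u * coframe ψ ν u (shapeOp ψ ν u (pd j ψ u)) l := by
  have hψ := hP.contDiffAt hu
  have hν := hP.contDiffAt_normal hu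
  -- `Γ a b` is the vector of Christoffel symbols `Γᵏ_{ab}`
  set Γ : Fin n → Fin n → Euc n → Euc n := fun a b w => coframe ψ ν w (pd a (pd b ψ) w) with hΓ
  have hΓd : ∀ a b, DifferentiableAt ℝ (Γ a b) u := fun a b =>
    ((hP.contDiffAt_coframe hu).clm_apply (contDiffAt_pd (contDiffAt_pd hψ b) a)).differentiableAt
      (by simp)
  have hpd : ∀ m a b c, pd m (christoffel g c a b) u = pd m (Γ a b) u c := by
    intro m a b c
    rw [← pd_apply_coord (hΓd a b)]
    refine pd_congr ?_ m
    filter_upwards [hP.eventually_mem hu] with w hw using hP.christoffel_eq hg hw c a b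
  -- the derivative of the Gauss formula `∂_a ∂_b ψ = Γᵏ_{ab} ∂_k ψ + h_{ab} ν`
  have key : ∀ m a b, coframe ψ ν u (pd m (pd a (pd b ψ)) u) =
      ∑ c, Γ a b u c • Γ m c u + pd m (Γ a b) u
        - sff ψ ν a b u • coframe ψ ν u (shapeOp ψ ν u (pd m ψ u)) := by
    intro m a b
    have h : pd a (pd b ψ) =ᶠ[nhds u] fun w => fderiv ℝ ψ w (Γ a b w) + sff ψ ν a b w • ν w := by
      filter_upwards [hP.eventually_mem hu] with w hw using hP.pd_pd_eq hw a b
    have hd' := (contDiffAt_fderiv hψ).differentiableAt (by simp)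
    have hh := (hP.contDiffAt_sff hu a b).differentiableAt (by simp)
    have hνd := hν.differentiableAt (by simp)
    have h1 : pd m (pd a (pd b ψ)) u = fderiv ℝ ψ u (pd m (Γ a b) u)
        + fderiv ℝ (fderiv ℝ ψ) u (EuclideanSpace.single m 1) (Γ a b u)
        + (sff ψ ν a b u • pd m ν u + pd m (sff ψ ν a b) u • ν u) := by
      rw [pd_congr h]
      unfold pd
      rw [fderiv_fun_add (hd'.clm_apply (hΓd a b)) (hh.fun_smul hνd), fderiv_clm_apply hd' (hΓd a b),
        fderiv_fun_smul hh hνd]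
      simp
    have h2 : pd m ν u = -shapeOp ψ ν u (pd m ψ u) := hP.fderiv_normal hu _
    rw [h1, h2, map_add, map_add, map_add, hP.coframe_fderiv hu, map_smul, map_smul,
      hP.coframe_normal hu, clm_apply_eq_sum (fderiv ℝ (fderiv ℝ ψ) u (EuclideanSpace.single m 1)),
      map_sum, map_neg]
    simp only [map_smul, ← pd_pd hψ, hΓ]
    rw [smul_zero, add_zero, smul_neg]
    abel
  have hk := key i j k
  rw [pd_comm (contDiffAt_pd hψ k), key j i k] at hk
  have hkl := congrArg (fun v : Euc n => v l) hk
  simp only [PiLp.add_apply, PiLp.sub_apply, PiLp.smul_apply, smul_eq_mul, WithLp.ofLp_sum,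
    Finset.sum_apply] at hkl
  have hs : ∀ a b, ∑ m, christoffel g l a m u * christoffel g m b k u =
      ∑ m, Γ b k u m * Γ a m u l := fun a b => Finset.sum_congr rfl fun m _ => by
    rw [hP.christoffel_eq hg hu, hP.christoffel_eq hg hu, mul_comm]
  rw [curvature, hpd, hpd, Finset.sum_sub_distrib, hs, hs]
  linarith

/-- The Lie derivative of the metric along the tangential part of the position vector. -/
lemma lieDerivMetric_eq (hg : IsInducedMetric U ψ g) {ξ : Euc n → Euc n}
    (hξ : ∀ w ∈ U, ψ w = fderiv ℝ ψ w (ξ w) + support ψ ν w • ν w) (hu : u ∈ U) (i j : Fin n) :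
    lieDerivMetric ξ g i j u = 2 * (g u i j + support ψ ν u * sff ψ ν i j u) := by
  have hψ := hP.contDiffAt hu
  have hξ' : ∀ w ∈ U, ξ w = coframe ψ ν w (ψ w) := by
    intro w hw
    conv_rhs => rw [hξ w hw]
    simp [hP.coframe_fderiv hw, hP.coframe_normal hw]
  have hξd : DifferentiableAt ℝ ξ u := by
    have h : ξ =ᶠ[nhds u] fun w => coframe ψ ν w (ψ w) := by
      filter_upwards [hP.eventually_mem hu] with w hw using hξ' w hw
    exact (((hP.contDiffAt_coframe hu).clm_apply hψ).differentiableAt (by simp)).congr_of_eventuallyEq h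
  have hd' := (contDiffAt_fderiv hψ).differentiableAt (by simp)
  have hρd := (hP.contDiffAt_support hu).differentiableAt (by simp)
  have hνd := (hP.contDiffAt_normal hu).differentiableAt (by simp)
  -- the derivative of `ψ = dψ ξ + ρ ν`, paired with a tangent vector
  have key : ∀ a b, g u a b = ∑ k, (ξ u k * inner ℝ (pd k (pd a ψ) u) (pd b ψ u)
      + g u k b * pd a (fun w => ξ w k) u) - support ψ ν u * sff ψ ν a b u := by
    intro a b
    have h : ψ =ᶠ[nhds u] fun w => fderiv ℝ ψ w (ξ w) + support ψ ν w • ν w := by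
      filter_upwards [hP.eventually_mem hu] with w hw using hξ w hw
    have h1 : pd a ψ u = fderiv ℝ ψ u (pd a ξ u)
        + fderiv ℝ (fderiv ℝ ψ) u (EuclideanSpace.single a 1) (ξ u)
        + (support ψ ν u • pd a ν u + pd a (support ψ ν) u • ν u) := by
      rw [pd_congr h]
      unfold pd
      rw [fderiv_fun_add (hd'.clm_apply hξd) (hρd.fun_smul hνd), fderiv_clm_apply hd' hξd,
        fderiv_fun_smul hρd hνd]
      simp
    have h2 : pd a ν u = -shapeOp ψ ν u (pd a ψ u) := hP.fderiv_normal hu _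
    have h3 : (inner ℝ (ν u) (pd b ψ u) : ℝ) = 0 := by
      rw [real_inner_comm]; exact hP.normal u hu _
    rw [hg u hu]
    conv_lhs => rw [h1]
    rw [h2, inner_add_left, inner_add_left, inner_add_left, inner_smul_left, inner_smul_left, h3,
      inner_neg_left, clm_apply_eq_sum, clm_apply_eq_sum (fderiv ℝ (fderiv ℝ ψ) u _) (ξ u),
      sum_inner, sum_inner, Finset.sum_add_distrib, sff]
    have e1 : ∑ k, (inner ℝ (pd a ξ u k • fderiv ℝ ψ u (EuclideanSpace.single k 1)) (pd b ψ u) : ℝ)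
        = ∑ k, g u k b * pd a (fun w => ξ w k) u := Finset.sum_congr rfl fun k _ => by
      rw [inner_smul_left, pd_apply_coord hξd, hg u hu, mul_comm]; rfl
    have e2 : ∑ k, (inner ℝ (ξ u k • fderiv ℝ (fderiv ℝ ψ) u (EuclideanSpace.single a 1)
        (EuclideanSpace.single k 1)) (pd b ψ u) : ℝ)
        = ∑ k, ξ u k * inner ℝ (pd k (pd a ψ) u) (pd b ψ u) := Finset.sum_congr rfl fun k _ => by
      rw [inner_smul_left, pd_comm hψ, pd_pd hψ]; rfl
    rw [e1, e2]
    simp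
    ring
  have hsymm : ∀ a b, g u a b = g u b a := fun a b => by rw [hg u hu, hg u hu, real_inner_comm]
  have k1 := key i j
  have k2 := key j i
  rw [hP.sff_comm hu j i] at k2
  have hsum : lieDerivMetric ξ g i j u =
      ∑ k, (ξ u k * inner ℝ (pd k (pd i ψ) u) (pd j ψ u) + g u k j * pd i (fun w => ξ w k) u)
      + ∑ k, (ξ u k * inner ℝ (pd k (pd j ψ) u) (pd i ψ u) + g u k i * pd j (fun w => ξ w k) u) := by
    rw [lieDerivMetric, ← Finset.sum_add_distrib]
    refine Finset.sum_congr rfl fun k _ => ?_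
    rw [hP.pd_metric hg hu, hsymm i k, real_inner_comm (pd i ψ u)]
    ring
  rw [hsum]
  linarith [hsymm i j]

lemma trace_eq_sum (hu : u ∈ U) (T : Euc (n + 1) →L[ℝ] Euc (n + 1)) :
    traceCLM (n + 1) T =
      ∑ i, coframe ψ ν u (T (pd i ψ u)) i + inner ℝ (T (ν u)) (ν u) := by
  obtain ⟨e, he⟩ := hP.frameMap_isInvertible hu
  let b := ((EuclideanSpace.basisFun (Fin n) ℝ).toBasis.prod (Module.Basis.singleton Unit ℝ)).map
    e.toLinearEquiv
  have he' : ∀ x, e x = fderiv ℝ ψ u x.1 + x.2 • ν u := fun x => by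
    have : e x = frameMap ψ ν u x := by rw [← he]; rfl
    rw [this]; simp [frameMap]
  have hes : ∀ w, e.symm w = (coframe ψ ν u w, (inner ℝ w (ν u) : ℝ)) := fun w => by
    rw [ContinuousLinearEquiv.symm_apply_eq, he']
    exact hP.decomp hu w
  rw [traceCLM_apply, LinearMap.trace_eq_matrix_trace ℝ b, Matrix.trace, Fintype.sum_sum_type]
  congr 1
  · refine Finset.sum_congr rfl fun i _ => ?_
    simp [b, LinearMap.toMatrix_apply, he', hes, pd]
  · simp [b, LinearMap.toMatrix_apply, he', hes]

/-- The Ricci soliton equation with constant `1` for the tangential part of the position vector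
amounts to `S² = (tr S + ρ) S`. -/
lemma shapeOp_sq (hg : IsInducedMetric U ψ g) {ξ : Euc n → Euc n}
    (hξ : ∀ w ∈ U, ψ w = fderiv ℝ ψ w (ξ w) + support ψ ν w • ν w) (hu : u ∈ U)
    (hsol : ∀ i j, (1 / 2) * lieDerivMetric ξ g i j u + ricci g i j u = g u i j) :
    shapeOp ψ ν u ∘L shapeOp ψ ν u =
      (traceCLM (n + 1) (shapeOp ψ ν u) + support ψ ν u) • shapeOp ψ ν u := by
  set S := shapeOp ψ ν u with hS
  have h1 : ∀ j k, inner ℝ (S (S (pd j ψ u))) (pd k ψ u) =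
      (traceCLM (n + 1) S + support ψ ν u) * (inner ℝ (S (pd j ψ u)) (pd k ψ u) : ℝ) := by
    intro j k
    have hs := hsol j k
    rw [hP.lieDerivMetric_eq hg hξ hu, ricci] at hs
    have hr : ∑ i, curvature g i k i j u = sff ψ ν j k u * traceCLM (n + 1) S
        - inner ℝ (S (S (pd j ψ u))) (pd k ψ u) := by
      have hss : S (pd j ψ u) = ∑ i, coframe ψ ν u (S (pd j ψ u)) i • pd i ψ u := by
        conv_lhs => rw [hP.decomp hu (S (pd j ψ u)), hP.inner_shapeOp_normal hu, zero_smul,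
          add_zero, clm_apply_eq_sum]
        rfl
      rw [hP.trace_eq_sum hu, hP.shapeOp_normal hu, inner_zero_left, add_zero]
      conv_rhs => enter [2]; rw [hss, map_sum, sum_inner]
      rw [Finset.mul_sum, ← Finset.sum_sub_distrib]
      refine Finset.sum_congr rfl fun i _ => ?_
      rw [hP.gauss hg hu, map_smul, inner_smul_left, sff, sff, mul_comm (inner ℝ (S (pd i ψ u)) _)]
      rfl
    rw [hr] at hs
    have : sff ψ ν j k u = inner ℝ (S (pd j ψ u)) (pd k ψ u) := rfl
    rw [this] at hs
    linarith
  -- both sides agree on tangent vectors up to a normal component, which vanishes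
  have h2 : ∀ j, S (S (pd j ψ u)) = (traceCLM (n + 1) S + support ψ ν u) • S (pd j ψ u) := by
    intro j
    rw [← sub_eq_zero, ← inner_self_eq_zero (𝕜 := ℝ)]
    set w := S (S (pd j ψ u)) - (traceCLM (n + 1) S + support ψ ν u) • S (pd j ψ u) with hw
    have hwk : ∀ k, (inner ℝ w (pd k ψ u) : ℝ) = 0 := fun k => by
      rw [hw, inner_sub_left, inner_smul_left, h1]; simp
    have hwν : (inner ℝ w (ν u) : ℝ) = 0 := by
      rw [hw, inner_sub_left, inner_smul_left, hP.inner_shapeOp_normal hu,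
        hP.inner_shapeOp_normal hu]; simp
    conv_lhs => enter [3]; rw [hP.decomp hu w]
    rw [inner_add_right, inner_smul_right, hwν, clm_apply_eq_sum, inner_sum]
    simp only [inner_smul_right, mul_zero, add_zero]
    exact Finset.sum_eq_zero fun k _ => by
      rw [show (inner ℝ w (fderiv ℝ ψ u (EuclideanSpace.single k 1)) : ℝ) = 0 from hwk k, mul_zero]
  ext1 w
  rw [hP.decomp hu w, clm_apply_eq_sum (fderiv ℝ ψ u)]
  simp only [map_add, map_sum, map_smul, ContinuousLinearMap.comp_apply,
    smul_apply]
  have hSν : S (ν u) = 0 := hP.shapeOp_normal hu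
  rw [hSν, map_zero, smul_zero, smul_zero, smul_zero]
  congr 1
  exact Finset.sum_congr rfl fun k _ => congrArg _ (h2 k)

end IsPatch

/-! ### Patches whose shape operator satisfies `S² = (tr S + ρ) S` -/

section Projections

variable {n : ℕ} (ψ ν : Euc n → Euc (n + 1))

/-- The function `κ = tr S + ρ`, which is the only possible nonzero principal curvature. -/
def principalCurv (u : Euc n) : ℝ := traceCLM (n + 1) (shapeOp ψ ν u) + support ψ ν u

/-- The operator `Q = κ⁻¹ S`; where `S ≠ 0` it projects onto the principal directions of principal
curvature `κ`. -/
def principalProj (u : Euc n) : Euc (n + 1) →L[ℝ] Euc (n + 1) :=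
  (principalCurv ψ ν u)⁻¹ • shapeOp ψ ν u

/-- The orthogonal projection `w ↦ ⟨ν, w⟩ ν` onto the normal line. -/
def normalProj (u : Euc n) : Euc (n + 1) →L[ℝ] Euc (n + 1) :=
  (innerSL ℝ (ν u)).smulRight (ν u)

/-- The operator `Q + ν ⊗ ν`; where `S ≠ 0` it projects onto the sum of the normal line and the
space of principal directions of principal curvature `κ`. -/
def cylinderProj (u : Euc n) : Euc (n + 1) →L[ℝ] Euc (n + 1) :=
  principalProj ψ ν u + normalProj ν u

/-- The points of `U` at which the nonzero principal curvature `κ` has multiplicity `k`. -/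
def multSet (U : Set (Euc n)) (k : ℕ) : Set (Euc n) :=
  {u ∈ U | shapeOp ψ ν u ≠ 0 ∧ traceCLM (n + 1) (principalProj ψ ν u) = k}

variable {ψ ν}

lemma normalProj_apply (u : Euc n) (w : Euc (n + 1)) :
    normalProj ν u w = (inner ℝ (ν u) w : ℝ) • ν u := rfl

lemma cylinderProj_apply (u : Euc n) (w : Euc (n + 1)) : cylinderProj ψ ν u w =
    principalProj ψ ν u w + (inner ℝ (ν u) w : ℝ) • ν u := rfl

end Projections

lemma fderiv_clm_apply_const {E F G : Type*} [NormedAddCommGroup E] [NormedSpace ℝ E]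
    [NormedAddCommGroup F] [NormedSpace ℝ F] [NormedAddCommGroup G] [NormedSpace ℝ G]
    {A : E → F →L[ℝ] G} {u : E} (hA : DifferentiableAt ℝ A u) (w : F) (v : E) :
    fderiv ℝ (fun x => A x w) u v = fderiv ℝ A u v w := by
  rw [fderiv_clm_apply hA (differentiableAt_const w)]
  simp

lemma fderiv_clm_apply_apply {E F G : Type*} [NormedAddCommGroup E] [NormedSpace ℝ E]
    [NormedAddCommGroup F] [NormedSpace ℝ F] [NormedAddCommGroup G] [NormedSpace ℝ G]
    {A : E → F →L[ℝ] G} {f : E → F} {u : E} (hA : DifferentiableAt ℝ A u)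
    (hf : DifferentiableAt ℝ f u) (v : E) :
    fderiv ℝ (fun x => A x (f x)) u v = A u (fderiv ℝ f u v) + fderiv ℝ A u v (f u) := by
  rw [fderiv_clm_apply hA hf]
  simp

/-- The trace of a projection is its rank. -/
lemma trace_eq_finrank_range {m : ℕ} {T : Euc m →L[ℝ] Euc m} (hT : ∀ w, T (T w) = T w) :
    traceCLM m T = Module.finrank ℝ (LinearMap.range T.toLinearMap) := by
  rw [traceCLM_apply]
  refine LinearMap.IsProj.trace (p := LinearMap.range T.toLinearMap)
    ⟨fun x => LinearMap.mem_range_self _ x, ?_⟩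
  rintro _ ⟨y, rfl⟩
  exact hT y

namespace IsPatch

variable {n : ℕ} {U : Set (Euc n)} {ψ ν : Euc n → Euc (n + 1)} (hP : IsPatch U ψ ν) {u : Euc n}
  {k : ℕ}
include hP

lemma ext_frame (hu : u ∈ U) {x : Euc (n + 1)} (h : ∀ v, inner ℝ x (fderiv ℝ ψ u v) = (0 : ℝ))
    (h' : inner ℝ x (ν u) = (0 : ℝ)) : x = 0 := by
  rw [← inner_self_eq_zero (𝕜 := ℝ)]
  conv_lhs => enter [3]; rw [hP.decomp hu x]
  rw [inner_add_right, h, inner_smul_right, h', mul_zero, add_zero]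

lemma contDiffAt_principalCurv (hu : u ∈ U) : ContDiffAt ℝ ∞ (principalCurv ψ ν) u :=
  ((traceCLM (n + 1)).contDiff.contDiffAt.comp u (hP.contDiffAt_shapeOp hu)).add
    (hP.contDiffAt_support hu)

lemma trace_normalProj (hu : u ∈ U) : traceCLM (n + 1) (normalProj ν u) = 1 := by
  have h : ∀ i, (inner ℝ (ν u) (pd i ψ u) : ℝ) = 0 := fun i => by
    rw [real_inner_comm]; exact hP.normal u hu _
  rw [hP.trace_eq_sum hu]
  simp only [normalProj_apply, h, hP.inner_normal_self hu, one_smul]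
  simp

lemma contDiffAt_normalProj (hu : u ∈ U) : ContDiffAt ℝ ∞ (normalProj ν) u :=
  ((innerSL ℝ).contDiff.contDiffAt.comp u (hP.contDiffAt_normal hu)).smulRight
    (hP.contDiffAt_normal hu)

lemma fderiv_normalProj (hu : u ∈ U) (v : Euc n) (w : Euc (n + 1)) :
    fderiv ℝ (normalProj ν) u v w =
      (inner ℝ (ν u) w : ℝ) • fderiv ℝ ν u v + (inner ℝ (fderiv ℝ ν u v) w : ℝ) • ν u := by
  have hν := (hP.contDiffAt_normal hu).differentiableAt (by simp)
  rw [← fderiv_clm_apply_const ((hP.contDiffAt_normalProj hu).differentiableAt (by simp))]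
  simp only [normalProj_apply]
  rw [fderiv_fun_smul (hν.inner ℝ (differentiableAt_const w)) hν]
  simp only [add_apply, smul_apply, ContinuousLinearMap.smulRight_apply]
  rw [fderiv_inner_apply ℝ hν (differentiableAt_const w)]
  simp

variable (hsq : ∀ u ∈ U, shapeOp ψ ν u ∘L shapeOp ψ ν u = principalCurv ψ ν u • shapeOp ψ ν u)
include hsq

lemma principalCurv_ne_zero (hu : u ∈ U) (hS : shapeOp ψ ν u ≠ 0) : principalCurv ψ ν u ≠ 0 := by
  intro h0
  apply hS
  ext1 w
  have h : shapeOp ψ ν u (shapeOp ψ ν u w) = principalCurv ψ ν u • shapeOp ψ ν u w :=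
    congrArg (fun T => T w) (hsq u hu)
  rw [h0, zero_smul] at h
  rw [zero_apply]
  rw [← inner_self_eq_zero (𝕜 := ℝ), hP.shapeOp_symm hu, h, inner_zero_right]

lemma shapeOp_eq_smul (hu : u ∈ U) (hS : shapeOp ψ ν u ≠ 0) :
    shapeOp ψ ν u = principalCurv ψ ν u • principalProj ψ ν u := by
  rw [principalProj, smul_inv_smul₀ (hP.principalCurv_ne_zero hsq hu hS)]

lemma principalProj_idem (hu : u ∈ U) (hS : shapeOp ψ ν u ≠ 0) (w : Euc (n + 1)) :
    principalProj ψ ν u (principalProj ψ ν u w) = principalProj ψ ν u w := by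
  have hκ := hP.principalCurv_ne_zero hsq hu hS
  have h := congrArg (fun T => T w) (hsq u hu)
  simp only [ContinuousLinearMap.comp_apply, smul_apply] at h
  simp only [principalProj, smul_apply, map_smul, h]
  rw [inv_smul_smul₀ hκ]

omit hsq in
lemma principalProj_symm (hu : u ∈ U) (x y : Euc (n + 1)) :
    inner ℝ (principalProj ψ ν u x) y = (inner ℝ x (principalProj ψ ν u y) : ℝ) := by
  simp [principalProj, inner_smul_left, inner_smul_right, hP.shapeOp_symm hu]

omit hsq in
lemma principalProj_normal (hu : u ∈ U) : principalProj ψ ν u (ν u) = 0 := by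
  simp [principalProj, hP.shapeOp_normal hu]

omit hsq in
lemma inner_principalProj_normal (hu : u ∈ U) (w : Euc (n + 1)) :
    inner ℝ (principalProj ψ ν u w) (ν u) = (0 : ℝ) := by
  simp [principalProj, inner_smul_left, hP.inner_shapeOp_normal hu]

omit hsq in
lemma fderiv_coframe_principalProj (hu : u ∈ U) (w : Euc (n + 1)) :
    fderiv ℝ ψ u (coframe ψ ν u (principalProj ψ ν u w)) = principalProj ψ ν u w := by
  have h := hP.decomp hu (principalProj ψ ν u w)
  rw [hP.inner_principalProj_normal hu, zero_smul, add_zero] at h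
  exact h.symm

lemma contDiffAt_principalProj (hu : u ∈ U) (hS : shapeOp ψ ν u ≠ 0) :
    ContDiffAt ℝ ∞ (principalProj ψ ν) u :=
  ((hP.contDiffAt_principalCurv hu).inv (hP.principalCurv_ne_zero hsq hu hS)).smul
    (hP.contDiffAt_shapeOp hu)

lemma trace_principalProj (hu : u ∈ U) (hS : shapeOp ψ ν u ≠ 0) :
    traceCLM (n + 1) (principalProj ψ ν u) =
      Module.finrank ℝ (LinearMap.range (principalProj ψ ν u).toLinearMap) :=
  trace_eq_finrank_range (hP.principalProj_idem hsq hu hS)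

omit hsq in
lemma eventually_shapeOp_ne_zero (hu : u ∈ U) (hS : shapeOp ψ ν u ≠ 0) :
    ∀ᶠ w in nhds u, shapeOp ψ ν w ≠ 0 :=
  (hP.contDiffAt_shapeOp hu).continuousAt.eventually_ne hS

/-- The multiplicity of the nonzero principal curvature is locally constant, being the trace of a
continuous family of projections. -/
lemma isOpen_multSet (k : ℕ) : IsOpen (multSet ψ ν U k) := by
  rw [isOpen_iff_mem_nhds]
  rintro u ⟨hu, hS, htr⟩
  have hc : ContinuousAt (fun w => traceCLM (n + 1) (principalProj ψ ν w)) u :=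
    (traceCLM (n + 1)).continuous.continuousAt.comp
      (hP.contDiffAt_principalProj hsq hu hS).continuousAt
  have h1 : ∀ᶠ w in nhds u, |traceCLM (n + 1) (principalProj ψ ν w) - k| < 1 := by
    have := (hc.sub (continuousAt_const (y := (k : ℝ)))).abs
    exact Filter.Tendsto.eventually_lt_const (by simp [htr]) this
  filter_upwards [hP.eventually_mem hu, hP.eventually_shapeOp_ne_zero hu hS, h1] with w hw hSw hlt
  refine ⟨hw, hSw, ?_⟩
  rw [hP.trace_principalProj hsq hw hSw] at hlt ⊢
  rw [abs_lt] at hlt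
  have h2 : Module.finrank ℝ (LinearMap.range (principalProj ψ ν w).toLinearMap) < k + 1 := by
    exact_mod_cast (by linarith [hlt.2] : (Module.finrank ℝ
      (LinearMap.range (principalProj ψ ν w).toLinearMap) : ℝ) < k + 1)
  have h3 : k < Module.finrank ℝ (LinearMap.range (principalProj ψ ν w).toLinearMap) + 1 := by
    exact_mod_cast (by linarith [hlt.1] : (k : ℝ) < (Module.finrank ℝ
      (LinearMap.range (principalProj ψ ν w).toLinearMap) : ℝ) + 1)
  exact_mod_cast (by omega : Module.finrank ℝ _ = k)

lemma trace_shapeOp_of_mem (hu : u ∈ multSet ψ ν U k) :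
    traceCLM (n + 1) (shapeOp ψ ν u) = k * principalCurv ψ ν u := by
  obtain ⟨hu, hS, htr⟩ := hu
  rw [hP.shapeOp_eq_smul hsq hu hS, map_smul, htr, smul_eq_mul, mul_comm]

lemma support_eq_of_mem (hu : u ∈ multSet ψ ν U k) :
    support ψ ν u = (1 - k) * principalCurv ψ ν u := by
  have h1 := hP.trace_shapeOp_of_mem hsq hu
  have h2 : principalCurv ψ ν u = traceCLM (n + 1) (shapeOp ψ ν u) + support ψ ν u := rfl
  linarith

lemma fderiv_support_eq_of_mem (hu : u ∈ multSet ψ ν U k) (v : Euc n) :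
    fderiv ℝ (support ψ ν) u v = (1 - k) * fderiv ℝ (principalCurv ψ ν) u v := by
  have h : support ψ ν =ᶠ[nhds u] fun w => ((1 : ℝ) - k) * principalCurv ψ ν w := by
    filter_upwards [(hP.isOpen_multSet hsq k).mem_nhds hu] with w hw
      using hP.support_eq_of_mem hsq hw
  rw [h.fderiv_eq, fderiv_const_mul
    ((hP.contDiffAt_principalCurv hu.1).differentiableAt (by simp))]
  simp

/-- The derivative of `Q² = Q`; it shows that `D_v Q` maps the image of `Q` into its kernel. -/
lemma principalProj_fderiv_principalProj (hu : u ∈ U) (hS : shapeOp ψ ν u ≠ 0) (v : Euc n)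
    (w : Euc (n + 1)) :
    fderiv ℝ (principalProj ψ ν) u v w = principalProj ψ ν u (fderiv ℝ (principalProj ψ ν) u v w)
      + fderiv ℝ (principalProj ψ ν) u v (principalProj ψ ν u w) := by
  have hQ := (hP.contDiffAt_principalProj hsq hu hS).differentiableAt (by simp)
  have h : (fun x => principalProj ψ ν x (principalProj ψ ν x w)) =ᶠ[nhds u]
      fun x => principalProj ψ ν x w := by
    filter_upwards [hP.eventually_mem hu, hP.eventually_shapeOp_ne_zero hu hS] with x hx hSx
      using hP.principalProj_idem hsq hx hSx w
  have h1 := congrArg (fun L : Euc n →L[ℝ] Euc (n + 1) => L v) h.fderiv_eq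
  rw [fderiv_clm_apply_apply hQ (hQ.clm_apply (differentiableAt_const w)),
    fderiv_clm_apply_const hQ] at h1
  exact h1.symm

lemma principalProj_fderiv_eq_zero (hu : u ∈ U) (hS : shapeOp ψ ν u ≠ 0) (v : Euc n)
    {w : Euc (n + 1)} (hw : principalProj ψ ν u w = w) :
    principalProj ψ ν u (fderiv ℝ (principalProj ψ ν) u v w) = 0 := by
  have h := hP.principalProj_fderiv_principalProj hsq hu hS v w
  rw [hw] at h
  simpa using h

lemma fderiv_principalProj_symm (hu : u ∈ U) (hS : shapeOp ψ ν u ≠ 0) (v : Euc n)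
    (x y : Euc (n + 1)) :
    inner ℝ (fderiv ℝ (principalProj ψ ν) u v x) y =
      (inner ℝ x (fderiv ℝ (principalProj ψ ν) u v y) : ℝ) := by
  have hQ := (hP.contDiffAt_principalProj hsq hu hS).differentiableAt (by simp)
  have h : (fun w => (inner ℝ (principalProj ψ ν w x) y : ℝ)) =ᶠ[nhds u]
      fun w => inner ℝ x (principalProj ψ ν w y) := by
    filter_upwards [hP.eventually_mem hu] with w hw using hP.principalProj_symm hw x y
  have h1 := congrArg (fun L : Euc n →L[ℝ] ℝ => L v) h.fderiv_eq
  rw [fderiv_inner_apply ℝ (hQ.clm_apply (differentiableAt_const x)) (differentiableAt_const y),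
    fderiv_inner_apply ℝ (differentiableAt_const x) (hQ.clm_apply (differentiableAt_const y)),
    fderiv_clm_apply_const hQ, fderiv_clm_apply_const hQ] at h1
  simpa using h1

lemma fderiv_principalProj_normal (hu : u ∈ U) (hS : shapeOp ψ ν u ≠ 0) (v : Euc n) :
    fderiv ℝ (principalProj ψ ν) u v (ν u) = shapeOp ψ ν u (fderiv ℝ ψ u v) := by
  have hQ := (hP.contDiffAt_principalProj hsq hu hS).differentiableAt (by simp)
  have hν := (hP.contDiffAt_normal hu).differentiableAt (by simp)
  have h : (fun w => principalProj ψ ν w (ν w)) =ᶠ[nhds u] fun _ => 0 := by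
    filter_upwards [hP.eventually_mem hu] with w hw using hP.principalProj_normal hw
  have h1 := congrArg (fun L : Euc n →L[ℝ] Euc (n + 1) => L v) h.fderiv_eq
  rw [fderiv_clm_apply_apply hQ hν, hP.fderiv_normal hu, map_neg] at h1
  have h2 : principalProj ψ ν u (shapeOp ψ ν u (fderiv ℝ ψ u v)) =
      shapeOp ψ ν u (fderiv ℝ ψ u v) := by
    rw [hP.shapeOp_eq_smul hsq hu hS]
    simp [hP.principalProj_idem hsq hu hS]
  rw [h2] at h1
  simp only [fderiv_fun_const, Pi.zero_apply, zero_apply] at h1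
  rw [neg_add_eq_zero] at h1
  exact h1.symm

/-- The Codazzi equation in terms of `κ` and `Q`. -/
lemma codazzi_principalProj (hu : u ∈ U) (hS : shapeOp ψ ν u ≠ 0) (v w : Euc n) :
    fderiv ℝ (principalCurv ψ ν) u v • principalProj ψ ν u (fderiv ℝ ψ u w)
        + principalCurv ψ ν u • fderiv ℝ (principalProj ψ ν) u v (fderiv ℝ ψ u w) =
      fderiv ℝ (principalCurv ψ ν) u w • principalProj ψ ν u (fderiv ℝ ψ u v)
        + principalCurv ψ ν u • fderiv ℝ (principalProj ψ ν) u w (fderiv ℝ ψ u v) := by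
  have hQ := (hP.contDiffAt_principalProj hsq hu hS).differentiableAt (by simp)
  have hκ := (hP.contDiffAt_principalCurv hu).differentiableAt (by simp)
  have h : shapeOp ψ ν =ᶠ[nhds u] fun w => principalCurv ψ ν w • principalProj ψ ν w := by
    filter_upwards [hP.eventually_mem hu, hP.eventually_shapeOp_ne_zero hu hS] with x hx hSx
      using hP.shapeOp_eq_smul hsq hx hSx
  have hc := hP.codazzi hu v w
  rw [h.fderiv_eq, fderiv_fun_smul hκ hQ] at hc
  simpa [add_comm] using hc

lemma fderiv_principalCurv_eq_zero (hk : 2 ≤ k) (hu : u ∈ multSet ψ ν U k) (v : Euc n) :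
    fderiv ℝ (principalCurv ψ ν) u v = 0 := by
  obtain ⟨huU, hS, htr⟩ := id hu
  have hκ := hP.principalCurv_ne_zero hsq huU hS
  have hk' : (2 : ℝ) ≤ k := by exact_mod_cast hk
  -- `κ` is constant along the kernel of `Q`, as `dρ = -⟨x, S ·⟩` and `ρ = (1 - k) κ`
  have hker : ∀ a, principalProj ψ ν u (fderiv ℝ ψ u a) = 0 →
      fderiv ℝ (principalCurv ψ ν) u a = 0 := by
    intro a ha
    have h1 := hP.fderiv_support_eq_of_mem hsq hu a
    rw [hP.fderiv_support huU, hP.shapeOp_eq_smul hsq huU hS, smul_apply, ha, smul_zero,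
      inner_zero_right, neg_zero] at h1
    rcases mul_eq_zero.1 h1.symm with h2 | h2
    · linarith
    · exact h2
  -- `κ` is constant along the image of `Q` by the Codazzi equation, as `Q` has rank at least two
  have him : ∀ a, principalProj ψ ν u (fderiv ℝ ψ u a) = fderiv ℝ ψ u a →
      fderiv ℝ (principalCurv ψ ν) u a = 0 := by
    intro a ha
    by_contra hne
    have hle : Module.finrank ℝ (LinearMap.range (principalProj ψ ν u).toLinearMap) ≤ 1 := by
      refine finrank_le_one ⟨fderiv ℝ ψ u a, ⟨_, ha⟩⟩ ?_
      rintro ⟨_, ⟨y, rfl⟩⟩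
      set b := coframe ψ ν u (principalProj ψ ν u y) with hb
      have hb1 : fderiv ℝ ψ u b = principalProj ψ ν u y := hP.fderiv_coframe_principalProj huU y
      have hb2 : principalProj ψ ν u (fderiv ℝ ψ u b) = fderiv ℝ ψ u b := by
        rw [hb1, hP.principalProj_idem hsq huU hS]
      have hc := congrArg (principalProj ψ ν u) (hP.codazzi_principalProj hsq huU hS a b)
      simp only [map_add, map_smul, hP.principalProj_fderiv_eq_zero hsq huU hS _ hb2,
        hP.principalProj_fderiv_eq_zero hsq huU hS _ ha, smul_zero, add_zero, ha, hb2] at hc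
      refine ⟨(fderiv ℝ (principalCurv ψ ν) u a)⁻¹ * fderiv ℝ (principalCurv ψ ν) u b, ?_⟩
      apply Subtype.ext
      change _ • fderiv ℝ ψ u a = principalProj ψ ν u y
      rw [mul_smul, ← hc, inv_smul_smul₀ hne, hb1]
    rw [hP.trace_principalProj hsq huU hS] at htr
    have : Module.finrank ℝ (LinearMap.range (principalProj ψ ν u).toLinearMap) = k := by
      exact_mod_cast htr
    omega
  set a := coframe ψ ν u (principalProj ψ ν u (fderiv ℝ ψ u v)) with hadef
  have ha : fderiv ℝ ψ u a = principalProj ψ ν u (fderiv ℝ ψ u v) :=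
    hP.fderiv_coframe_principalProj huU _
  have h1 := him a (by rw [ha, hP.principalProj_idem hsq huU hS])
  have h2 := hker (v - a) (by rw [map_sub, map_sub, ha, hP.principalProj_idem hsq huU hS, sub_self])
  rw [map_sub, h1, sub_zero] at h2
  exact h2

/-- The position vector has no component in the principal directions of curvature `κ`. -/
lemma principalProj_position (hk : 2 ≤ k) (hu : u ∈ multSet ψ ν U k) :
    principalProj ψ ν u (ψ u) = 0 := by
  have h : shapeOp ψ ν u (ψ u) = 0 := by
    refine hP.ext_frame hu.1 (fun v => ?_) (hP.inner_shapeOp_normal hu.1 _)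
    have h1 := hP.fderiv_support hu.1 v
    rw [hP.fderiv_support_eq_of_mem hsq hu, hP.fderiv_principalCurv_eq_zero hsq hk hu, mul_zero] at h1
    rw [hP.shapeOp_symm hu.1]
    linarith
  rw [principalProj, smul_apply, h, smul_zero]

lemma fderiv_principalProj_comm (hk : 2 ≤ k) (hu : u ∈ multSet ψ ν U k) (v w : Euc n) :
    fderiv ℝ (principalProj ψ ν) u v (fderiv ℝ ψ u w) =
      fderiv ℝ (principalProj ψ ν) u w (fderiv ℝ ψ u v) := by
  have h := hP.codazzi_principalProj hsq hu.1 hu.2.1 v w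
  simp only [hP.fderiv_principalCurv_eq_zero hsq hk hu, zero_smul, zero_add] at h
  exact smul_right_injective _ (hP.principalCurv_ne_zero hsq hu.1 hu.2.1) h

/-- The nonzero principal curvature satisfies `(k - 1) κ² = 1`, by differentiating `Q ψ = 0` along
a principal direction. -/
lemma principalCurv_sq (hk : 2 ≤ k) (hu : u ∈ multSet ψ ν U k) :
    ((k : ℝ) - 1) * principalCurv ψ ν u ^ 2 = 1 := by
  obtain ⟨huU, hS, htr⟩ := id hu
  have hκ := hP.principalCurv_ne_zero hsq huU hS
  have hQ := (hP.contDiffAt_principalProj hsq huU hS).differentiableAt (by simp)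
  have hψ := (hP.contDiffAt huU).differentiableAt (by simp)
  obtain ⟨y, hy⟩ : ∃ y, principalProj ψ ν u y ≠ 0 := by
    by_contra! h
    apply hS
    rw [hP.shapeOp_eq_smul hsq huU hS]
    ext1 w
    simp [h]
  set v := coframe ψ ν u (principalProj ψ ν u y) with hv
  have hv1 : fderiv ℝ ψ u v = principalProj ψ ν u y := hP.fderiv_coframe_principalProj huU y
  have hv2 : principalProj ψ ν u (fderiv ℝ ψ u v) = fderiv ℝ ψ u v := by
    rw [hv1, hP.principalProj_idem hsq huU hS]
  have h : (fun w => principalProj ψ ν w (ψ w)) =ᶠ[nhds u] fun _ => 0 := by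
    filter_upwards [(hP.isOpen_multSet hsq k).mem_nhds hu] with w hw
      using hP.principalProj_position hsq hk hw
  have h1 := congrArg (fun L : Euc n →L[ℝ] Euc (n + 1) => L v) h.fderiv_eq
  rw [fderiv_clm_apply_apply hQ hψ, hv2, hP.decomp huU (ψ u), map_add, map_smul,
    hP.fderiv_principalProj_normal hsq huU hS, hP.fderiv_principalProj_comm hsq hk hu] at h1
  have h2 := congrArg (principalProj ψ ν u) h1
  simp only [map_add, map_smul, hP.principalProj_fderiv_eq_zero hsq huU hS _ hv2, zero_add, hv2,
    fderiv_fun_const, Pi.zero_apply, zero_apply, map_zero] at h2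
  have h3 : principalProj ψ ν u (shapeOp ψ ν u (fderiv ℝ ψ u v)) =
      principalCurv ψ ν u • fderiv ℝ ψ u v := by
    rw [hP.shapeOp_eq_smul hsq huU hS]
    simp [hv2]
  have h4 : (inner ℝ (ψ u) (ν u) : ℝ) = (1 - k) * principalCurv ψ ν u :=
    hP.support_eq_of_mem hsq hu
  rw [h3, h4, smul_smul] at h2
  have h5 : (1 + (1 - (k : ℝ)) * principalCurv ψ ν u * principalCurv ψ ν u) • fderiv ℝ ψ u v = 0 := by
    rw [add_smul, one_smul, h2]
  rcases smul_eq_zero.1 h5 with h6 | h6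
  · linarith
  · exact absurd (hv1 ▸ h6) hy

/-- `⟨(D_v Q) w, z⟩` is symmetric in the tangent vectors `v`, `w`, `z` and vanishes if `w`, `z` lie
both in the image or both in the kernel of `Q`, so it vanishes. -/
lemma inner_fderiv_principalProj (hk : 2 ≤ k) (hu : u ∈ multSet ψ ν U k) (v w z : Euc n) :
    inner ℝ (fderiv ℝ (principalProj ψ ν) u v (fderiv ℝ ψ u w)) (fderiv ℝ ψ u z) = (0 : ℝ) := by
  obtain ⟨huU, hS, htr⟩ := id hu
  set T : Euc n → Euc n → Euc n → ℝ := fun v w z =>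
    inner ℝ (fderiv ℝ (principalProj ψ ν) u v (fderiv ℝ ψ u w)) (fderiv ℝ ψ u z) with hT
  have hc1 : ∀ a b c, T a b c = T b a c := fun a b c => by
    simp only [hT, hP.fderiv_principalProj_comm hsq hk hu a b]
  have hc2 : ∀ a b c, T a b c = T a c b := fun a b c => by
    simp only [hT]
    rw [hP.fderiv_principalProj_symm hsq huU hS, real_inner_comm]
  have him : ∀ a b c, principalProj ψ ν u (fderiv ℝ ψ u b) = fderiv ℝ ψ u b →
      principalProj ψ ν u (fderiv ℝ ψ u c) = fderiv ℝ ψ u c → T a b c = 0 := by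
    intro a b c hb hc
    simp only [hT]
    rw [← hc, ← hP.principalProj_symm huU, hP.principalProj_fderiv_eq_zero hsq huU hS a hb,
      inner_zero_left]
  have hker : ∀ a b c, principalProj ψ ν u (fderiv ℝ ψ u b) = 0 →
      principalProj ψ ν u (fderiv ℝ ψ u c) = 0 → T a b c = 0 := by
    intro a b c hb hc
    simp only [hT]
    rw [hP.principalProj_fderiv_principalProj hsq huU hS, hb, map_zero, add_zero,
      hP.principalProj_symm huU, hc, inner_zero_right]
  have hsplit : ∀ x : Euc n, ∃ a b, x = a + b ∧
      principalProj ψ ν u (fderiv ℝ ψ u a) = fderiv ℝ ψ u a ∧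
      principalProj ψ ν u (fderiv ℝ ψ u b) = 0 := by
    intro x
    have ha := hP.fderiv_coframe_principalProj huU (fderiv ℝ ψ u x)
    refine ⟨coframe ψ ν u (principalProj ψ ν u (fderiv ℝ ψ u x)), _, (add_sub_cancel _ x).symm,
      ?_, ?_⟩
    · rw [ha, hP.principalProj_idem hsq huU hS]
    · rw [map_sub, map_sub, ha, hP.principalProj_idem hsq huU hS, sub_self]
  have hmixed : ∀ x b c, principalProj ψ ν u (fderiv ℝ ψ u b) = fderiv ℝ ψ u b →
      principalProj ψ ν u (fderiv ℝ ψ u c) = 0 → T x b c = 0 := by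
    intro x b c hb hc
    obtain ⟨a, d, rfl, ha, hd⟩ := hsplit x
    have hadd : T (a + d) b c = T a b c + T d b c := by
      simp [hT, inner_add_left]
    rw [hadd, hc2 a, hc1 a, him _ _ _ ha hb, hc1 d, hker _ _ _ hd hc, add_zero]
  change T v w z = 0
  obtain ⟨a, b, rfl, ha, hb⟩ := hsplit w
  obtain ⟨c, d, rfl, hc, hd⟩ := hsplit z
  have hadd : T v (a + b) (c + d) = T v a c + T v a d + T v b c + T v b d := by
    simp [hT, inner_add_left, inner_add_right]
    ring
  rw [hadd, him _ _ _ ha hc, hmixed _ _ _ ha hd, hc2 v b c, hmixed _ _ _ hc hb, hker _ _ _ hb hd]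
  simp

lemma fderiv_cylinderProj (hk : 2 ≤ k) (hu : u ∈ multSet ψ ν U k) :
    fderiv ℝ (cylinderProj ψ ν) u = 0 := by
  obtain ⟨huU, hS, htr⟩ := id hu
  have hQ := (hP.contDiffAt_principalProj hsq huU hS).differentiableAt (by simp)
  have hN := (hP.contDiffAt_normalProj huU).differentiableAt (by simp)
  ext1 v
  have h : ∀ w, fderiv ℝ (cylinderProj ψ ν) u v w = fderiv ℝ (principalProj ψ ν) u v w
      + ((inner ℝ (ν u) w : ℝ) • fderiv ℝ ν u v + (inner ℝ (fderiv ℝ ν u v) w : ℝ) • ν u) := by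
    intro w
    rw [← hP.fderiv_normalProj huU, show cylinderProj ψ ν =
      fun x => principalProj ψ ν x + normalProj ν x from rfl, fderiv_fun_add hQ hN]
    simp
  have hν : fderiv ℝ (cylinderProj ψ ν) u v (ν u) = 0 := by
    rw [h, hP.fderiv_principalProj_normal hsq huU hS, hP.inner_normal_self huU,
      hP.inner_fderiv_normal huU, hP.fderiv_normal huU]
    simp
  have ht : ∀ x, fderiv ℝ (cylinderProj ψ ν) u v (fderiv ℝ ψ u x) = 0 := by
    intro x
    have hx : (inner ℝ (ν u) (fderiv ℝ ψ u x) : ℝ) = 0 := by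
      rw [real_inner_comm]; exact hP.normal u huU x
    rw [h, hx, zero_smul, zero_add]
    refine hP.ext_frame huU (fun z => ?_) ?_
    · have hz : (inner ℝ (ν u) (fderiv ℝ ψ u z) : ℝ) = 0 := by
        rw [real_inner_comm]; exact hP.normal u huU z
      rw [inner_add_left, hP.inner_fderiv_principalProj hsq hk hu, inner_smul_left, hz]
      simp
    · rw [inner_add_left, inner_smul_left, hP.inner_normal_self huU,
        hP.fderiv_principalProj_symm hsq huU hS, hP.fderiv_principalProj_normal hsq huU hS,
        hP.fderiv_normal huU, inner_neg_left, real_inner_comm (fderiv ℝ ψ u x)]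
      simp
  ext1 w
  rw [hP.decomp huU w, map_add, ht, map_smul, hν]
  simp

lemma cylinderProj_eventually_eq (hk : 2 ≤ k) (hu : u ∈ multSet ψ ν U k) :
    ∀ᶠ w in nhds u, cylinderProj ψ ν w = cylinderProj ψ ν u := by
  obtain ⟨r, hr, hball⟩ := Metric.isOpen_iff.1 (hP.isOpen_multSet hsq k) u hu
  filter_upwards [Metric.ball_mem_nhds u hr] with w hw
  refine Metric.isOpen_ball.is_const_of_fderiv_eq_zero (𝕜 := ℝ) (convex_ball u r).isPreconnected
    (fun x hx => ?_) (fun x hx => hP.fderiv_cylinderProj hsq hk (hball hx)) hw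
    (Metric.mem_ball_self hr)
  obtain ⟨hxU, hS, -⟩ := hball hx
  exact (((hP.contDiffAt_principalProj hsq hxU hS).add
    (hP.contDiffAt_normalProj hxU)).differentiableAt (by simp)).differentiableWithinAt

lemma cylinderProj_idem (hu : u ∈ U) (hS : shapeOp ψ ν u ≠ 0) (w : Euc (n + 1)) :
    cylinderProj ψ ν u (cylinderProj ψ ν u w) = cylinderProj ψ ν u w := by
  have h : (inner ℝ (ν u) (principalProj ψ ν u w) : ℝ) = 0 := by
    rw [real_inner_comm]; exact hP.inner_principalProj_normal hu w
  simp only [cylinderProj_apply, map_add, map_smul, hP.principalProj_idem hsq hu hS,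
    hP.principalProj_normal hu, h, hP.inner_normal_self hu]
  simp

omit hsq in
lemma cylinderProj_symm (hu : u ∈ U) (x y : Euc (n + 1)) :
    inner ℝ (cylinderProj ψ ν u x) y = (inner ℝ x (cylinderProj ψ ν u y) : ℝ) := by
  simp only [cylinderProj_apply, inner_add_left, inner_add_right, inner_smul_left,
    inner_smul_right, hP.principalProj_symm hu, real_inner_comm x (ν u)]
  simp [mul_comm]

lemma finrank_ker_cylinderProj (hu : u ∈ U) (hS : shapeOp ψ ν u ≠ 0) :
    (Module.finrank ℝ (LinearMap.ker (cylinderProj ψ ν u).toLinearMap) : ℝ) +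
      traceCLM (n + 1) (principalProj ψ ν u) = n := by
  have h1 := trace_eq_finrank_range (hP.cylinderProj_idem hsq hu hS)
  rw [cylinderProj, map_add, hP.trace_normalProj hu] at h1
  have h2 := LinearMap.finrank_range_add_finrank_ker (cylinderProj ψ ν u).toLinearMap
  rw [finrank_euclideanSpace_fin] at h2
  have h3 : (Module.finrank ℝ (LinearMap.range (cylinderProj ψ ν u).toLinearMap) : ℝ) +
      Module.finrank ℝ (LinearMap.ker (cylinderProj ψ ν u).toLinearMap) = n + 1 := by
    exact_mod_cast h2
  rw [cylinderProj] at h3 ⊢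
  linarith

/-- Near a point where `κ` has multiplicity `k ≥ 2`, the patch lies on a spherical cylinder. -/
lemma norm_cylinderProj_sq (hk : 2 ≤ k) (hu : u ∈ multSet ψ ν U k) :
    ‖cylinderProj ψ ν u (ψ u)‖ ^ 2 = (k : ℝ) - 1 := by
  have h4 : (inner ℝ (ν u) (ψ u) : ℝ) = (1 - k) * principalCurv ψ ν u := by
    rw [real_inner_comm]; exact hP.support_eq_of_mem hsq hu
  rw [cylinderProj_apply, hP.principalProj_position hsq hk hu, zero_add, norm_smul,
    hP.norm_normal u hu.1, mul_one, h4, Real.norm_eq_abs, sq_abs]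
  linear_combination ((k : ℝ) - 1) * hP.principalCurv_sq hsq hk hu

end IsPatch

/-! ### Unit normals of parametrized hypersurfaces -/

section Normal

variable {n : ℕ}

/-- The generalized cross product of the partial derivatives of `ψ`: the vector representing
`w ↦ det (w, ∂_1 ψ, …, ∂_n ψ)`. -/
def crossNormal (ψ : Euc n → Euc (n + 1)) (u : Euc n) : Euc (n + 1) :=
  WithLp.toLp 2 fun i => (-1) ^ (i : ℕ) *
    Matrix.det (Matrix.of fun (a : Fin n) (b : Fin n) => pd a ψ u (i.succAbove b))

lemma inner_crossNormal (ψ : Euc n → Euc (n + 1)) (u : Euc n) (w : Euc (n + 1)) :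
    inner ℝ w (crossNormal ψ u) = Matrix.det (Matrix.of
      (Fin.cons w.ofLp fun a => (pd a ψ u).ofLp : Fin (n + 1) → Fin (n + 1) → ℝ)) := by
  rw [Matrix.det_succ_row_zero, PiLp.inner_apply]
  refine Finset.sum_congr rfl fun i _ => ?_
  simp only [crossNormal, RCLike.inner_apply, conj_trivial, Matrix.of_apply, Fin.cons_zero]
  rw [mul_right_comm]
  rfl

lemma contDiffAt_crossNormal {ψ : Euc n → Euc (n + 1)} {u : Euc n} (hψ : ContDiffAt ℝ ∞ ψ u) :
    ContDiffAt ℝ ∞ (crossNormal ψ) u := by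
  rw [contDiffAt_piLp]
  intro i
  simp only [crossNormal, Matrix.det_apply, Matrix.of_apply]
  refine contDiffAt_const.mul (ContDiffAt.sum fun σ _ => ContDiffAt.const_smul _ ?_)
  exact contDiffAt_prod fun a _ => (contDiffAt_piLp 2).1 (contDiffAt_pd hψ (σ a)) _

lemma crossNormal_ne_zero {ψ : Euc n → Euc (n + 1)} {u : Euc n}
    (hψ : Function.Injective (fderiv ℝ ψ u)) : crossNormal ψ u ≠ 0 := by
  have hli : LinearIndependent ℝ fun a => pd a ψ u := by
    have := ((EuclideanSpace.basisFun (Fin n) ℝ).toBasis.linearIndependent).map'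
      (fderiv ℝ ψ u).toLinearMap (LinearMap.ker_eq_bot.2 hψ)
    have h2 : (fun a => pd a ψ u) = (fderiv ℝ ψ u).toLinearMap ∘
        (EuclideanSpace.basisFun (Fin n) ℝ).toBasis := by
      funext a
      simp [pd]
    rw [h2]
    exact this
  obtain ⟨w, hw⟩ : ∃ w, w ∉ Submodule.span ℝ (Set.range fun a => pd a ψ u) := by
    by_contra! h
    have h1 : Submodule.span ℝ (Set.range fun a => pd a ψ u) = ⊤ := by
      rw [Submodule.eq_top_iff']; exact h
    have h2 := finrank_range_le_card (R := ℝ) fun a => pd a ψ u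
    rw [Set.finrank, h1, finrank_top] at h2
    simp at h2
  have hli' : LinearIndependent ℝ
      (Fin.cons w fun a => pd a ψ u : Fin (n + 1) → Euc (n + 1)) :=
    linearIndependent_finCons.2 ⟨hli, hw⟩
  have hrows := hli'.map' (WithLp.linearEquiv 2 ℝ (Fin (n + 1) → ℝ)).toLinearMap
    (LinearEquiv.ker _)
  intro h0
  have hdet := inner_crossNormal ψ u w
  rw [h0, inner_zero_right] at hdet
  have hrow : (Matrix.of
      (Fin.cons w.ofLp fun a => (pd a ψ u).ofLp : Fin (n + 1) → Fin (n + 1) → ℝ)).row =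
      (WithLp.linearEquiv 2 ℝ (Fin (n + 1) → ℝ)).toLinearMap ∘
        (Fin.cons w fun a => pd a ψ u : Fin (n + 1) → Euc (n + 1)) := by
    funext i
    refine Fin.cases ?_ (fun a => ?_) i <;> rfl
  rw [← hrow] at hrows
  have hunit := Matrix.linearIndependent_rows_iff_isUnit.1 hrows
  rw [Matrix.isUnit_iff_isUnit_det, ← hdet] at hunit
  simp at hunit

lemma exists_isPatch {U : Set (Euc n)} {ψ : Euc n → Euc (n + 1)} (hU : IsOpen U)
    (hψ : ContDiffOn ℝ ∞ ψ U) (hinj : ∀ u ∈ U, Function.Injective (fderiv ℝ ψ u)) :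
    ∃ ν, IsPatch U ψ ν := by
  refine ⟨fun u => ‖crossNormal ψ u‖⁻¹ • crossNormal ψ u, hU, hψ, fun u hu => ?_, hinj,
    fun u hu => ?_, fun u hu v => ?_⟩
  · have h0 := crossNormal_ne_zero (hinj u hu)
    have h1 := contDiffAt_crossNormal (hψ.contDiffAt (hU.mem_nhds hu))
    exact (((h1.norm ℝ h0).inv (norm_ne_zero_iff.2 h0)).smul h1).contDiffWithinAt
  · have h0 := crossNormal_ne_zero (hinj u hu)
    rw [norm_smul, norm_inv, norm_norm, inv_mul_cancel₀ (norm_ne_zero_iff.2 h0)]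
  · rw [inner_smul_right, clm_apply_eq_sum, sum_inner, Finset.sum_eq_zero, mul_zero]
    intro a _
    rw [inner_smul_left, inner_crossNormal, Matrix.det_zero_of_row_eq (Fin.succ_ne_zero a).symm,
      mul_zero]
    rfl

end Normal

/-! ### Patches of an immersed manifold -/

section Charts

variable {n : ℕ} {M : Type*} [TopologicalSpace M] [ChartedSpace (Euc n) M]

lemma charts_mdifferentiable [IsManifold (𝓡 n) ∞ M] {e : OpenPartialHomeomorph M (Euc n)}
    (he : e ∈ charts n M) : e.MDifferentiable (𝓡 n) (𝓡 n) :=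
  ⟨(contMDiffOn_of_mem_maximalAtlas he).mdifferentiableOn (by simp),
    (contMDiffOn_symm_of_mem_maximalAtlas he).mdifferentiableOn (by simp)⟩

variable [IsManifold (𝓡 n) ∞ M] {e : OpenPartialHomeomorph M (Euc n)} (he : e ∈ charts n M)
include he

lemma dParam_surjective {u : Euc n} (hu : u ∈ e.target) : Function.Surjective (dParam e u) :=
  (charts_mdifferentiable he).symm.mfderiv_surjective (by simpa using hu)

lemma dParam_injective {u : Euc n} (hu : u ∈ e.target) : Function.Injective (dParam e u) :=
  (charts_mdifferentiable he).symm.mfderiv_injective (by simpa using hu)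

lemma dParam_coordField (ξ : (p : M) → TangentSpace (𝓡 n) p) {u : Euc n} (hu : u ∈ e.target) :
    dParam e u (coordField ξ e u) = ξ (e.symm u) := by
  have h := (charts_mdifferentiable he).symm_comp_deriv (e.map_target hu)
  have h1 : (mfderiv (𝓡 n) (𝓡 n) e.symm (e (e.symm u)) : Euc n → Euc n) = dParam e u := by
    rw [e.right_inv hu]; rfl
  have h2 := congrArg (fun L : Euc n →L[ℝ] Euc n => L (ξ (e.symm u))) h
  exact (congrFun h1 _).symm.trans h2

omit [IsManifold (𝓡 n) ∞ M] in
lemma contDiffOn_comp_symm {V : Type*} [NormedAddCommGroup V] [NormedSpace ℝ V] {f : M → V}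
    (hf : ContMDiff (𝓡 n) 𝓘(ℝ, V) ∞ f) : ContDiffOn ℝ ∞ (fun u => f (e.symm u)) e.target :=
  (hf.comp_contMDiffOn (contMDiffOn_symm_of_mem_maximalAtlas he)).contDiffOn

lemma fderiv_comp_symm {V : Type*} [NormedAddCommGroup V] [NormedSpace ℝ V] {f : M → V} {u : Euc n}
    (hu : u ∈ e.target) (hf : MDifferentiableAt (𝓡 n) 𝓘(ℝ, V) f (e.symm u)) (v : Euc n) :
    fderiv ℝ (fun u => f (e.symm u)) u v =
      (mfderiv (𝓡 n) 𝓘(ℝ, V) f (e.symm u) : Euc n →L[ℝ] V) (dParam e u v) := by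
  have h := mfderiv_comp u hf ((charts_mdifferentiable he).mdifferentiableAt_symm hu)
  rw [mfderiv_eq_fderiv] at h
  exact congrArg (fun L : Euc n →L[ℝ] V => L v) h

variable {φ : M → Euc (n + 1)} {u : Euc n}

lemma fderiv_param (hφ : ContMDiff (𝓡 n) (𝓡 (n + 1)) ∞ φ) (hu : u ∈ e.target) (v : Euc n) :
    fderiv ℝ (fun u => φ (e.symm u)) u v = differential n φ (e.symm u) (dParam e u v) :=
  fderiv_comp_symm he hu (hφ.mdifferentiable (by simp) _) v

lemma tangentPlane_param (hφ : ContMDiff (𝓡 n) (𝓡 (n + 1)) ∞ φ) (hu : u ∈ e.target) :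
    tangentPlane n φ (e.symm u) =
      LinearMap.range (fderiv ℝ (fun u => φ (e.symm u)) u).toLinearMap := by
  ext w
  constructor
  · rintro ⟨v, rfl⟩
    obtain ⟨v', rfl⟩ := dParam_surjective he hu v
    exact ⟨v', fderiv_param he hφ hu v'⟩
  · rintro ⟨v, rfl⟩
    exact ⟨dParam e u v, (fderiv_param he hφ hu v).symm⟩

variable {g : Metric n M}

lemma exists_isPatch_param (hφ : IsIsometricImmersion g φ) :
    ∃ ν, IsPatch e.target (fun u => φ (e.symm u)) ν := by
  refine exists_isPatch e.open_target (contDiffOn_comp_symm he hφ.1) fun u hu => ?_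
  rw [injective_iff_map_eq_zero]
  intro v hv
  rw [fderiv_param he hφ.1 hu] at hv
  by_contra hne
  have hpos := g.pos (e.symm u) (dParam e u v) fun h =>
    hne (dParam_injective he hu (h.trans (map_zero _).symm))
  rw [hφ.2, hv, inner_zero_left] at hpos
  exact lt_irrefl _ hpos

lemma isInducedMetric_coordMetric (hφ : IsIsometricImmersion g φ) :
    IsInducedMetric e.target (fun u => φ (e.symm u)) (coordMetric g e) := by
  intro u hu i j
  rw [coordMetric, Matrix.of_apply, hφ.2, pd, pd, fderiv_param he hφ.1 hu, fderiv_param he hφ.1 hu]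

end Charts

/-! ### The relative nullity as a global invariant -/

section Nullity

variable {n : ℕ} {M : Type*} [TopologicalSpace M] [ChartedSpace (Euc n) M]

/-- The orthogonal projection of the ambient space onto the tangent space, as a function on `M`. -/
def tangentProj (φ : M → Euc (n + 1)) (p : M) : Euc (n + 1) →L[ℝ] Euc (n + 1) :=
  (tangentPlane n φ p).starProjection

/-- The derivative of `tangentProj` at a point. -/
def dTangentProj (φ : M → Euc (n + 1)) (p : M) :
    Euc n →L[ℝ] Euc (n + 1) →L[ℝ] Euc (n + 1) :=
  mfderiv (𝓡 n) 𝓘(ℝ, Euc (n + 1) →L[ℝ] Euc (n + 1)) (tangentProj φ) p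

/-- The common kernel of the derivatives of the tangential projection at `p`: everything if the
second fundamental form vanishes at `p`, and the relative nullity space of the second fundamental
form otherwise. It involves neither a chart nor a choice of unit normals. -/
def nullity (φ : M → Euc (n + 1)) (p : M) : Submodule ℝ (Euc (n + 1)) :=
  ⨅ v : Euc n, LinearMap.ker (dTangentProj φ p v).toLinearMap

lemma mem_nullity {φ : M → Euc (n + 1)} {p : M} {w : Euc (n + 1)} :
    w ∈ nullity φ p ↔ ∀ v, dTangentProj φ p v w = 0 := by
  simp [nullity, Submodule.mem_iInf]

variable [IsManifold (𝓡 n) ∞ M] {e : OpenPartialHomeomorph M (Euc n)} (he : e ∈ charts n M)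
  {φ : M → Euc (n + 1)} (hφ : ContMDiff (𝓡 n) (𝓡 (n + 1)) ∞ φ) {ν : Euc n → Euc (n + 1)}
  (hP : IsPatch e.target (fun u => φ (e.symm u)) ν) {u : Euc n} (hu : u ∈ e.target)
include he hφ hP hu

lemma normal_mem_orthogonal : ν u ∈ (tangentPlane n φ (e.symm u))ᗮ := by
  rw [tangentPlane_param he hφ hu, Submodule.mem_orthogonal]
  rintro _ ⟨v, rfl⟩
  exact hP.normal u hu v

lemma tangentProj_param : tangentProj φ (e.symm u) =
    ContinuousLinearMap.id ℝ (Euc (n + 1)) - normalProj ν u := by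
  ext1 w
  refine Submodule.eq_starProjection_of_mem_orthogonal (K := tangentPlane n φ (e.symm u)) ?_ ?_
  · rw [tangentPlane_param he hφ hu]
    refine ⟨coframe (fun u => φ (e.symm u)) ν u w, ?_⟩
    have h := hP.decomp hu w
    rw [sub_apply, normalProj_apply, real_inner_comm, ContinuousLinearMap.id_apply]
    exact eq_sub_of_add_eq h.symm
  · rw [sub_apply, ContinuousLinearMap.id_apply, sub_sub_cancel, normalProj_apply]
    exact Submodule.smul_mem _ _ (normal_mem_orthogonal he hφ hP hu)

lemma mem_nullity_param {w : Euc (n + 1)} :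
    w ∈ nullity φ (e.symm u) ↔ ∀ v, fderiv ℝ (normalProj ν) u v w = 0 := by
  have h1 : (fun x => tangentProj φ (e.symm x)) =ᶠ[nhds u]
      fun x => ContinuousLinearMap.id ℝ (Euc (n + 1)) - normalProj ν x := by
    filter_upwards [hP.eventually_mem hu] with x hx using tangentProj_param he hφ hP hx
  have h2 : MDifferentiableAt (𝓡 n) 𝓘(ℝ, Euc (n + 1) →L[ℝ] Euc (n + 1)) (tangentProj φ)
      (e.symm u) := by
    have hd : DifferentiableAt ℝ (fun x => ContinuousLinearMap.id ℝ (Euc (n + 1)) - normalProj ν x)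
        (e (e.symm u)) := by
      rw [e.right_inv hu]
      exact ((hP.contDiffAt_normalProj hu).differentiableAt (by simp)).const_sub _
    have hc := hd.mdifferentiableAt.comp (e.symm u)
      ((charts_mdifferentiable he).mdifferentiableAt (e.map_target hu))
    refine hc.congr_of_eventuallyEq ?_
    filter_upwards [e.open_source.mem_nhds (e.map_target hu)] with q hq
    have := tangentProj_param he hφ hP (e.map_source hq)
    rw [e.left_inv hq] at this
    exact this
  have h3 : ∀ v, dTangentProj φ (e.symm u) (dParam e u v) = -fderiv ℝ (normalProj ν) u v := by
    intro v
    have h := fderiv_comp_symm he hu h2 v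
    rw [h1.fderiv_eq, fderiv_const_sub, neg_apply] at h
    exact h.symm
  rw [mem_nullity]
  constructor
  · intro h v
    have := h (dParam e u v)
    rw [h3, neg_apply, neg_eq_zero] at this
    exact this
  · intro h v
    obtain ⟨v', rfl⟩ := dParam_surjective he hu v
    have := h3 v'
    rw [this, neg_apply, h, neg_zero]

lemma nullity_eq_top_iff :
    nullity φ (e.symm u) = ⊤ ↔ shapeOp (fun u => φ (e.symm u)) ν u = 0 := by
  rw [Submodule.eq_top_iff']
  simp only [mem_nullity_param he hφ hP hu, hP.fderiv_normalProj hu]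
  constructor
  · intro h
    have hν : ∀ v, fderiv ℝ ν u v = 0 := fun v => by
      have := h (ν u) v
      rw [hP.inner_normal_self hu, hP.inner_fderiv_normal hu] at this
      simpa using this
    ext1 w
    simp [shapeOp, hν]
  · intro h w v
    simp [hP.fderiv_normal hu, h]

lemma nullity_eq_ker
    (hsq : ∀ u ∈ e.target, shapeOp (fun u => φ (e.symm u)) ν u ∘L shapeOp (fun u => φ (e.symm u)) ν u
      = principalCurv (fun u => φ (e.symm u)) ν u • shapeOp (fun u => φ (e.symm u)) ν u)
    (hS : shapeOp (fun u => φ (e.symm u)) ν u ≠ 0) :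
    nullity φ (e.symm u) =
      LinearMap.ker (cylinderProj (fun u => φ (e.symm u)) ν u).toLinearMap := by
  ext w
  rw [mem_nullity_param he hφ hP hu, LinearMap.mem_ker]
  simp only [hP.fderiv_normalProj hu]
  change _ ↔ cylinderProj (fun u => φ (e.symm u)) ν u w = 0
  rw [cylinderProj_apply]
  have hκ := hP.principalCurv_ne_zero hsq hu hS
  constructor
  · intro h
    have h1 : ∀ v, (inner ℝ (fderiv ℝ ν u v) w : ℝ) = 0 := fun v => by
      have := congrArg (fun x => (inner ℝ x (ν u) : ℝ)) (h v)
      simpa only [inner_add_left, inner_smul_left, hP.inner_normal_self hu,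
        hP.inner_fderiv_normal hu, conj_trivial, mul_zero, zero_add, mul_one,
        inner_zero_left] using this
    have h2 : (inner ℝ (ν u) w : ℝ) = 0 := by
      by_contra hne
      apply hS
      have hν : ∀ v, fderiv ℝ ν u v = 0 := fun v => by
        have := h v
        rw [h1, zero_smul, add_zero] at this
        exact (smul_eq_zero.1 this).resolve_left hne
      ext1 w
      simp [shapeOp, hν]
    have h3 : shapeOp (fun u => φ (e.symm u)) ν u w = 0 := by
      refine hP.ext_frame hu (fun v => ?_) (hP.inner_shapeOp_normal hu _)
      have := h1 v
      rw [hP.fderiv_normal hu, inner_neg_left, neg_eq_zero, hP.shapeOp_symm hu] at this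
      rw [real_inner_comm]
      exact this
    rw [h2, zero_smul, add_zero, principalProj, smul_apply, h3, smul_zero]
  · intro h v
    have h2 : (inner ℝ (ν u) w : ℝ) = 0 := by
      have := congrArg (fun x => (inner ℝ x (ν u) : ℝ)) h
      simpa only [inner_add_left, hP.inner_principalProj_normal hu, inner_smul_left,
        hP.inner_normal_self hu, conj_trivial, mul_one, zero_add, inner_zero_left] using this
    rw [h2, zero_smul, add_zero] at h
    rw [h2, zero_smul, zero_add, hP.fderiv_normal hu, inner_neg_left, hP.shapeOp_symm hu,
      hP.shapeOp_eq_smul hsq hu hS, smul_apply, h]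
    simp

end Nullity

/-! ### The soliton equation in a chart -/

section Soliton

variable {n : ℕ} {M : Type*} [TopologicalSpace M] [ChartedSpace (Euc n) M]
  [IsManifold (𝓡 n) ∞ M] {g : Metric n M} {φ : M → Euc (n + 1)} (hφ : IsIsometricImmersion g φ)
  {e : OpenPartialHomeomorph M (Euc n)} (he : e ∈ charts n M) {ν : Euc n → Euc (n + 1)}
  (hP : IsPatch e.target (fun u => φ (e.symm u)) ν)
include hφ he hP

lemma position_decomp {ξ : (p : M) → TangentSpace (𝓡 n) p} (hξ : IsTangentialPosition φ ξ)
    {u : Euc n} (hu : u ∈ e.target) : φ (e.symm u) =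
      fderiv ℝ (fun u => φ (e.symm u)) u (coordField ξ e u) +
        support (fun u => φ (e.symm u)) ν u • ν u := by
  rw [fderiv_param he hφ.1 hu, dParam_coordField he ξ hu, ← sub_eq_iff_eq_add']
  have h := hξ (e.symm u)
  have ho : ∀ x ∈ tangentPlane n φ (e.symm u), (inner ℝ x (ν u) : ℝ) = 0 := fun x hx =>
    Submodule.inner_right_of_mem_orthogonal hx (normal_mem_orthogonal he hφ.1 hP hu)
  rw [← sub_eq_zero]
  refine hP.ext_frame hu (fun v => ?_) ?_
  · have hv : fderiv ℝ (fun u => φ (e.symm u)) u v ∈ tangentPlane n φ (e.symm u) := by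
      rw [tangentPlane_param he hφ.1 hu]; exact ⟨v, rfl⟩
    rw [inner_sub_left, Submodule.inner_left_of_mem_orthogonal hv h, inner_smul_left,
      real_inner_comm, ho _ hv, mul_zero, sub_zero]
  · have hd : (inner ℝ (differential n φ (e.symm u) (ξ (e.symm u))) (ν u) : ℝ) = 0 :=
      ho _ ⟨_, rfl⟩
    rw [inner_sub_left, inner_sub_left, hd, inner_smul_left, hP.inner_normal_self hu]
    simp [support]

lemma shapeOp_sq_of_soliton {ξ : (p : M) → TangentSpace (𝓡 n) p} (hξ : IsTangentialPosition φ ξ)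
    (hsol : IsRicciSoliton g ξ 1) : ∀ u ∈ e.target,
      shapeOp (fun u => φ (e.symm u)) ν u ∘L shapeOp (fun u => φ (e.symm u)) ν u
        = principalCurv (fun u => φ (e.symm u)) ν u • shapeOp (fun u => φ (e.symm u)) ν u :=
  fun u hu => hP.shapeOp_sq (isInducedMetric_coordMetric he hφ)
    (fun _ hw => position_decomp hφ he hP hξ hw) hu
    fun i j => by rw [hsol e he u hu i j, one_mul]

lemma secondFundForm_eq {u : Euc n} (hu : u ∈ e.target) (i j : Fin n) :
    secondFundForm φ e i j u = sff (fun u => φ (e.symm u)) ν i j u • ν u := by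
  have h : sff (fun u => φ (e.symm u)) ν i j u =
      inner ℝ (pd i (pd j fun w => φ (e.symm w)) u) (ν u) := by
    rw [pd_pd (hP.contDiffAt hu), hP.inner_snd_fderiv_normal hu]
    rfl
  rw [secondFundForm, Submodule.starProjection_orthogonal_val]
  change _ - tangentProj φ (e.symm u) _ = _
  rw [tangentProj_param he hφ.1 hP hu, h, sub_apply, ContinuousLinearMap.id_apply, sub_sub_cancel,
    normalProj_apply, real_inner_comm]

end Soliton

/-! ### Straight segments in conical patches -/

namespace IsPatch

variable {n : ℕ} {U : Set (Euc n)} {ψ ν : Euc n → Euc (n + 1)} (hP : IsPatch U ψ ν) {u : Euc n}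
include hP

/-- If the position vector is everywhere tangent then near any point the patch is the graph `F` of a
map over its tangent space that satisfies Euler's relation `dF_y y = F y`. -/
lemma exists_graph (hρ : ∀ u ∈ U, support ψ ν u = 0) (hu : u ∈ U) :
    ∃ η : Euc n → Euc n, η (coframe ψ ν u (ψ u)) = u ∧
      ∀ᶠ y in nhds (coframe ψ ν u (ψ u)), η y ∈ U ∧ ContDiffAt ℝ 2 η y ∧
        ContDiffAt ℝ 2 (fun y => ψ (η y)) y ∧
        (∀ x, coframe ψ ν u (fderiv ℝ (fun y => ψ (η y)) y x) = x) ∧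
        fderiv ℝ (fun y => ψ (η y)) y y = ψ (η y) := by
  set A := coframe ψ ν u with hA
  set f : Euc n → Euc n := fun x => A (ψ x) with hf
  have hψ := hP.contDiffAt hu
  have hfc : ContDiffAt ℝ ∞ f u := A.contDiff.contDiffAt.comp u hψ
  have hfd : HasFDerivAt f ((ContinuousLinearEquiv.refl ℝ (Euc n) : Euc n ≃L[ℝ] Euc n) :
      Euc n →L[ℝ] Euc n) u := by
    have h := A.hasFDerivAt.comp u (hψ.differentiableAt (by simp)).hasFDerivAt
    have h2 : A ∘L fderiv ℝ ψ u = ((ContinuousLinearEquiv.refl ℝ (Euc n) : Euc n ≃L[ℝ] Euc n) :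
        Euc n →L[ℝ] Euc n) := by
      ext1 v
      simp [hA, hP.coframe_fderiv hu]
    rw [h2] at h
    exact h
  set H := hfc.toOpenPartialHomeomorph f hfd (by simp) with hH
  have hHf : ∀ x, H x = f x := fun x => rfl
  have huH : u ∈ H.source := hfc.mem_toOpenPartialHomeomorph_source hfd (by simp)
  have hη0 : H.symm (f u) = u := H.left_inv huH
  have hfu : f u ∈ H.target := H.map_source huH
  have hηc : ContDiffAt ℝ ∞ H.symm (f u) := hfc.to_localInverse hfd (by simp)
  have hη2 : ContDiffAt ℝ 2 H.symm (f u) := hηc.of_le (WithTop.coe_le_coe.2 le_top)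
  refine ⟨H.symm, hη0, ?_⟩
  have e1 : ∀ᶠ y in nhds (f u), H.symm y ∈ U :=
    hη2.continuousAt.preimage_mem_nhds (by rw [hη0]; exact hP.isOpen.mem_nhds hu)
  filter_upwards [e1, hη2.eventually (by simp), H.open_target.mem_nhds hfu] with y hyU hy hyt
  have hψ2 : ContDiffAt ℝ 2 ψ (H.symm y) :=
    (hP.contDiffAt hyU).of_le (WithTop.coe_le_coe.2 le_top)
  have hF : ContDiffAt ℝ 2 (fun y => ψ (H.symm y)) y := hψ2.comp y hy
  have hFd := hF.differentiableAt (by simp)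
  have hchain : ∀ x, fderiv ℝ (fun y => ψ (H.symm y)) y x =
      fderiv ℝ ψ (H.symm y) (fderiv ℝ H.symm y x) := fun x => by
    rw [fderiv_fun_comp y (hψ2.differentiableAt (by simp)) (hy.differentiableAt (by simp))]
    rfl
  have hleft : ∀ x, A (fderiv ℝ (fun y => ψ (H.symm y)) y x) = x := by
    intro x
    have h : (fun z => A (ψ (H.symm z))) =ᶠ[nhds y] fun z => z := by
      filter_upwards [H.open_target.mem_nhds hyt] with z hz using H.right_inv hz
    have h1 := (A.hasFDerivAt.comp y hFd.hasFDerivAt).fderiv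
    have h2 : fderiv ℝ (fun z => A (ψ (H.symm z))) y x = x := by
      rw [h.fderiv_eq, fderiv_fun_id]; rfl
    exact (congrArg (fun L : Euc n →L[ℝ] Euc n => L x) h1.symm).trans h2
  refine ⟨hyU, hy, hF, hleft, ?_⟩
  have hinj : Function.Injective (fderiv ℝ H.symm y).toLinearMap := by
    intro a b hab
    rw [← hleft a, ← hleft b, hchain, hchain]
    exact congrArg (fun t => A (fderiv ℝ ψ (H.symm y) t)) hab
  obtain ⟨z, hz⟩ :=
    (LinearMap.injective_iff_surjective.1 hinj) (coframe ψ ν (H.symm y) (ψ (H.symm y)))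
  have hpos : fderiv ℝ (fun y => ψ (H.symm y)) y z = ψ (H.symm y) := by
    have hd := hP.decomp hyU (ψ (H.symm y))
    have h0 : (inner ℝ (ψ (H.symm y)) (ν (H.symm y)) : ℝ) = 0 := hρ _ hyU
    rw [h0, zero_smul, add_zero] at hd
    rw [hchain]
    conv_rhs => rw [hd]
    exact congrArg _ hz
  have hzy : z = y := by
    rw [← hleft z, hpos]
    exact H.right_inv hyt
  rw [hzy] at hpos
  exact hpos

/-- A patch whose position vector is everywhere tangent contains, around each of its points, a
segment of a line through the origin. -/
lemma exists_segment (hn : 0 < n) (hρ : ∀ u ∈ U, support ψ ν u = 0) (hu : u ∈ U) :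
    ∃ v : Euc (n + 1), v ≠ 0 ∧ ψ u ∈ Submodule.span ℝ {v} ∧ ∃ ε : ℝ, 0 < ε ∧ ∃ γ : ℝ → Euc n,
      ContinuousOn γ (Set.Ioo (-ε) ε) ∧ γ 0 = u ∧
        ∀ t ∈ Set.Ioo (-ε) ε, γ t ∈ U ∧ ψ (γ t) = ψ u + t • v := by
  obtain ⟨η, hη0, hη⟩ := hP.exists_graph hρ hu
  set A := coframe ψ ν u with hA
  set F : Euc n → Euc (n + 1) := fun y => ψ (η y) with hF
  -- the base point is `c • w`, where `c = 1` away from the origin and `c = 0` at the origin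
  obtain ⟨c, w, hw, hcw⟩ : ∃ (c : ℝ) (w : Euc n), w ≠ 0 ∧ A (ψ u) = c • w := by
    by_cases h : A (ψ u) = 0
    · exact ⟨0, EuclideanSpace.single ⟨0, hn⟩ 1, by simp, by simp [h]⟩
    · exact ⟨1, _, h, (one_smul _ _).symm⟩
  set l : ℝ → Euc n := fun t => (t + c) • w with hl
  have hl0 : l 0 = A (ψ u) := by simp [hl, hcw]
  have hlc : Continuous l := by fun_prop
  have hev : ∀ᶠ t in nhds (0 : ℝ), η (l t) ∈ U ∧ ContDiffAt ℝ 2 η (l t) ∧ ContDiffAt ℝ 2 F (l t) ∧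
      (∀ x, A (fderiv ℝ F (l t) x) = x) ∧ fderiv ℝ F (l t) (l t) = F (l t) :=
    hlc.continuousAt.eventually (by rw [hl0]; exact hη)
  obtain ⟨ε, hε, hball⟩ := Metric.eventually_nhds_iff.1 hev
  have hI : ∀ t ∈ Set.Ioo (-ε) ε, η (l t) ∈ U ∧ ContDiffAt ℝ 2 η (l t) ∧ ContDiffAt ℝ 2 F (l t) ∧
      (∀ x, A (fderiv ℝ F (l t) x) = x) ∧ fderiv ℝ F (l t) (l t) = F (l t) := fun t ht =>
    hball (by rw [Real.dist_eq, sub_zero, abs_lt]; exact ht)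
  set B : ℝ → Euc (n + 1) := fun t => fderiv ℝ F (l t) w with hB
  have hBF : ∀ t ∈ Set.Ioo (-ε) ε, F (l t) = (t + c) • B t := fun t ht => by
    rw [← (hI t ht).2.2.2.2]
    exact map_smul _ _ _
  have hld : ∀ t, HasDerivAt l w t := fun t => by
    simpa using ((hasDerivAt_id t).add_const c).smul_const w
  have hBc : ∀ t ∈ Set.Ioo (-ε) ε, ContDiffAt ℝ 1 B t := fun t ht => by
    have h1 : ContDiffAt ℝ 1 (fderiv ℝ F) (l t) := (hI t ht).2.2.1.fderiv_right (by norm_num)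
    have h2 : ContDiffAt ℝ 1 l t := by fun_prop
    exact (h1.comp t h2).clm_apply contDiffAt_const
  -- differentiating `F (l t) = (t + c) • B t`, where `B` is the velocity of `F ∘ l`
  have hB0 : ∀ t ∈ Set.Ioo (-ε) ε, (t + c) • deriv B t = 0 := by
    intro t ht
    have hBd := ((hBc t ht).differentiableAt (by simp)).hasDerivAt
    have h1 : HasDerivAt (fun t => F (l t)) (B t) t :=
      ((hI t ht).2.2.1.differentiableAt (by simp)).hasFDerivAt.comp_hasDerivAt t (hld t)
    have h2 : HasDerivAt (fun t => (t + c) • B t) ((t + c) • deriv B t + (1 : ℝ) • B t) t :=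
      ((hasDerivAt_id t).add_const c).smul hBd
    have h3 : (fun t => F (l t)) =ᶠ[nhds t] fun t => (t + c) • B t := by
      filter_upwards [Ioo_mem_nhds ht.1 ht.2] with s hs using hBF s hs
    have h4 := (h1.congr_of_eventuallyEq h3.symm).unique h2
    rw [one_smul] at h4
    exact right_eq_add.1 h4
  have hB1 : ∀ t ∈ Set.Ioo (-ε) ε, deriv B t = 0 := by
    intro t ht
    by_cases htc : t + c = 0
    · have hcont : ContinuousAt (deriv B) t := by
        have h1 : ContDiffAt ℝ 0 (fderiv ℝ B) t := (hBc t ht).fderiv_right (by norm_num)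
        exact (h1.clm_apply contDiffAt_const).continuousAt
      by_contra hne
      obtain ⟨s, ⟨hs1, hs2⟩, hs3⟩ := ((((hcont.eventually_ne hne).and
        (Ioo_mem_nhds ht.1 ht.2)).filter_mono nhdsWithin_le_nhds).and
          (self_mem_nhdsWithin (a := t) (s := {t}ᶜ))).exists
      refine hs1 ((smul_eq_zero.1 (hB0 s hs2)).resolve_left fun h => hs3 ?_)
      exact (show s = t by linarith)
    · exact (smul_eq_zero.1 (hB0 t ht)).resolve_left htc
  have h0 : (0 : ℝ) ∈ Set.Ioo (-ε) ε := ⟨by linarith, hε⟩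
  have hBconst : ∀ t ∈ Set.Ioo (-ε) ε, B t = B 0 := fun t ht =>
    isOpen_Ioo.is_const_of_deriv_eq_zero isPreconnected_Ioo
      (fun s hs => ((hBc s hs).differentiableAt (by simp)).differentiableWithinAt)
      (fun s hs => hB1 s hs) ht h0
  have hψu : ψ u = c • B 0 := by
    have := hBF 0 h0
    rw [hl0, hF] at this
    simpa [hη0] using this
  refine ⟨B 0, fun h => hw ?_, ?_, ε, hε, fun t => η (l t), fun t ht => ?_, ?_,
    fun t ht => ⟨(hI t ht).1, ?_⟩⟩
  · rw [← (hI 0 h0).2.2.2.1 w]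
    exact (congrArg A h).trans (map_zero A)
  · rw [hψu]
    exact Submodule.smul_mem _ _ (Submodule.mem_span_singleton_self _)
  · exact ((hI t ht).2.1.continuousAt.comp hlc.continuousAt).continuousWithinAt
  · change η (l 0) = u
    rw [hl0, hη0]
  · change F (l t) = _
    rw [hBF t ht, hBconst t ht, hψu, add_smul]
    exact add_comm _ _

/-! ### Patches of cylinders are open in the cylinder -/

/-- A patch on which `‖R x‖² = a` for a projection `R` fills a neighborhood of each of its points
in the cylinder `‖R x‖² = a`: apply the open mapping property of submersions to
`(v, s) ↦ ψ v + s R ψ v`. -/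
lemma eventually_mem_image_of_cylinder {R : Euc (n + 1) →L[ℝ] Euc (n + 1)}
    (hR : ∀ w, R (R w) = R w) {a : ℝ} (ha : 0 < a) (hcyl : ∀ v ∈ U, ‖R (ψ v)‖ ^ 2 = a)
    (hu : u ∈ U) (hRψ : R (ψ u) = support ψ ν u • ν u) :
    ∀ᶠ y in nhds (ψ u), ‖R y‖ ^ 2 = a → y ∈ ψ '' U := by
  have hρ : support ψ ν u ≠ 0 := by
    intro h
    have := hcyl u hu
    rw [hRψ, h, zero_smul, norm_zero] at this
    norm_num at this
    exact ha.ne this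
  set G : Euc n × ℝ → Euc (n + 1) := fun x => ψ x.1 + x.2 • R (ψ x.1) with hG
  have hψ := hP.contDiffAt hu
  have hGc : ContDiffAt ℝ ∞ G (u, 0) := by
    have h1 : ContDiffAt ℝ ∞ (fun x : Euc n × ℝ => ψ x.1) (u, 0) :=
      ContDiffAt.comp (u, (0 : ℝ)) (g := ψ) (f := Prod.fst) hψ contDiffAt_fst
    exact h1.add (contDiffAt_snd.smul (R.contDiff.contDiffAt.comp _ h1))
  have hs := hGc.hasStrictFDerivAt (by simp)
  have hG1 : ∀ v, fderiv ℝ G (u, 0) (v, 0) = fderiv ℝ ψ u v := by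
    intro v
    have h1 : HasFDerivAt (fun x : Euc n => (x, (0 : ℝ))) (ContinuousLinearMap.inl ℝ (Euc n) ℝ) u :=
      hasFDerivAt_prodMk_left u 0
    have h2 := HasFDerivAt.comp u (f := fun x : Euc n => (x, (0 : ℝ))) hs.hasFDerivAt h1
    have h3 : G ∘ (fun x : Euc n => (x, (0 : ℝ))) = ψ := by
      funext x
      simp [hG]
    rw [h3] at h2
    rw [h2.fderiv]
    simp
  have hG2 : fderiv ℝ G (u, 0) (0, 1) = R (ψ u) := by
    have h1 : HasFDerivAt (fun s : ℝ => (u, s)) (ContinuousLinearMap.inr ℝ (Euc n) ℝ) 0 :=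
      hasFDerivAt_prodMk_right u 0
    have h2 := (HasFDerivAt.comp (0 : ℝ) (f := fun s : ℝ => (u, s)) hs.hasFDerivAt h1)
    have h3 : HasDerivAt (fun s : ℝ => ψ u + s • R (ψ u)) ((1 : ℝ) • R (ψ u)) 0 :=
      ((hasDerivAt_id (0 : ℝ)).smul_const (R (ψ u))).const_add (ψ u)
    have h4 := h2.hasDerivAt.unique h3
    simpa using h4
  have hsurj : (fderiv ℝ G (u, 0)).range = ⊤ := by
    rw [LinearMap.range_eq_top]
    intro w
    refine ⟨(coframe ψ ν u w, (support ψ ν u)⁻¹ * inner ℝ w (ν u)), ?_⟩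
    have hdec : (coframe ψ ν u w, (support ψ ν u)⁻¹ * (inner ℝ w (ν u) : ℝ)) =
        (coframe ψ ν u w, (0 : ℝ)) +
          ((support ψ ν u)⁻¹ * (inner ℝ w (ν u) : ℝ)) • ((0 : Euc n), (1 : ℝ)) := by
      simp
    rw [hdec]
    change fderiv ℝ G (u, 0) _ = w
    rw [map_add, map_smul, hG1, hG2, hRψ, smul_smul, mul_right_comm, inv_mul_cancel₀ hρ, one_mul]
    exact (hP.decomp hu w).symm
  have hmap := hs.map_nhds_eq_of_surj hsurj
  have hnhds : U ×ˢ Set.Ioo (-1 : ℝ) 1 ∈ nhds (u, (0 : ℝ)) :=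
    prod_mem_nhds (hP.isOpen.mem_nhds hu) (Ioo_mem_nhds (by norm_num) (by norm_num))
  have himg := Filter.image_mem_map (m := G) hnhds
  rw [hmap, show G (u, 0) = ψ u by simp [hG]] at himg
  filter_upwards [himg]
  rintro _ ⟨⟨v, s⟩, ⟨hv, hs1, hs2⟩, rfl⟩ hy
  have h1 : R (G (v, s)) = (1 + s) • R (ψ v) := by
    simp [hG, hR, add_smul]
  rw [h1, norm_smul, mul_pow, hcyl v hv, Real.norm_eq_abs, sq_abs] at hy
  have h2 : s * (2 + s) = 0 := by
    have : a * (s * (2 + s)) = 0 := by linarith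
    exact (mul_eq_zero.1 this).resolve_left ha.ne'
  have h3 : s = 0 := (mul_eq_zero.1 h2).resolve_right (by simp only at hs1; linarith)
  exact ⟨v, hv, by simp [hG, h3]⟩

end IsPatch

/-- Up to a linear isometry, the spherical hypercylinder is given by `‖R x‖² = k - 1` for `R` the
orthogonal projection onto a given subspace of dimension `k + 1`. -/
lemma exists_isometry_cylinder {n k : ℕ} (W : Submodule ℝ (Euc (n + 1)))
    (hW : Module.finrank ℝ W = k + 1) :
    ∃ T : Euc (n + 1) ≃ₗᵢ[ℝ] Euc (n + 1),
      T '' sphericalHypercylinder n k = {x | ‖W.starProjection x‖ ^ 2 = (k : ℝ) - 1} := by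
  let bW := (stdOrthonormalBasis ℝ W).reindex (finCongr hW)
  let v : Fin (n + 1) → Euc (n + 1) := fun i => if h : i.val < k + 1 then bW ⟨i, h⟩ else 0
  let s : Set (Fin (n + 1)) := {i | i.val < k + 1}
  have hvs : ∀ i (h : i.val < k + 1), v i = bW ⟨i, h⟩ := fun i h => dif_pos h
  have hv : Orthonormal ℝ (s.domRestrict v) := by
    have h1 : Orthonormal ℝ fun j : Fin (k + 1) => (bW j : Euc (n + 1)) :=
      bW.orthonormal.comp_linearIsometry W.subtypeₗᵢ
    have h2 : s.domRestrict v = (fun j : Fin (k + 1) => (bW j : Euc (n + 1))) ∘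
        fun i : s => (⟨i.1.val, i.2⟩ : Fin (k + 1)) := by
      funext i
      exact hvs i.1 i.2
    rw [h2]
    refine h1.comp _ fun i j hij => ?_
    exact Subtype.ext (Fin.ext (by simpa using hij))
  obtain ⟨b, hb⟩ := hv.exists_orthonormalBasis_extension_of_card_eq (by simp)
  have hle : k + 1 ≤ n + 1 := by
    have := W.finrank_le
    rwa [hW, finrank_euclideanSpace_fin] at this
  have hnorm : ∀ x, ‖W.starProjection x‖ ^ 2 =
      ∑ i : Fin (n + 1) with i.val < k + 1, b.repr x i ^ 2 := by
    intro x
    rw [← b.sum_sq_norm_inner_right, Finset.sum_filter]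
    refine Finset.sum_congr rfl fun i _ => ?_
    rw [Real.norm_eq_abs, sq_abs]
    split_ifs with hi
    · rw [b.repr_apply_apply, ← Submodule.inner_starProjection_left_eq_right,
        Submodule.starProjection_eq_self_iff.2]
      rw [hb i hi, hvs i hi]
      exact (bW _).2
    · have h0 : (inner ℝ (b i) (W.starProjection x) : ℝ) = 0 := by
        have hx : W.starProjection x = ∑ j, inner ℝ (bW j) (W.orthogonalProjectionOnto x) •
            (bW j : Euc (n + 1)) := by
          have := congrArg (Subtype.val) (bW.sum_repr' (W.orthogonalProjectionOnto x))
          rw [Submodule.starProjection_apply, ← this]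
          simp
        rw [hx, inner_sum]
        refine Finset.sum_eq_zero fun j _ => ?_
        have hj : (bW j : Euc (n + 1)) = b ⟨j, by omega⟩ := by
          have hjs : (⟨j, by omega⟩ : Fin (n + 1)) ∈ s := j.2
          rw [hb _ hjs, hvs _ hjs]
        rw [hj, inner_smul_right, b.inner_eq_ite, if_neg, mul_zero]
        intro hij
        exact hi (by rw [hij]; exact j.2)
      rw [h0]
      norm_num
  refine ⟨b.repr.symm, ?_⟩
  ext x
  rw [Set.mem_ofPred_eq, hnorm]
  constructor
  · rintro ⟨z, hz, rfl⟩
    simpa [sphericalHypercylinder] using hz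
  · intro hx
    exact ⟨b.repr x, hx, b.repr.symm_apply_apply x⟩

/-! ### Global arguments -/

section Global

variable {n : ℕ} {M : Type*} [TopologicalSpace M] [ChartedSpace (Euc n) M]

/-- In every chart and for every choice of unit normals, the shape operator of `φ` satisfies
`S² = κ S` with `κ = tr S + ρ`. -/
def IsShapeQuadratic (φ : M → Euc (n + 1)) : Prop :=
  ∀ e ∈ charts n M, ∀ ν, IsPatch e.target (fun u => φ (e.symm u)) ν → ∀ u ∈ e.target,
    shapeOp (fun u => φ (e.symm u)) ν u ∘L shapeOp (fun u => φ (e.symm u)) ν u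
      = principalCurv (fun u => φ (e.symm u)) ν u • shapeOp (fun u => φ (e.symm u)) ν u

/-- The squared norm of the normal part of the position vector. -/
def normalPartSq (φ : M → Euc (n + 1)) (p : M) : ℝ := ‖φ p - tangentProj φ p (φ p)‖ ^ 2

variable [IsManifold (𝓡 n) ∞ M] {g : Metric n M} {φ : M → Euc (n + 1)}
  (hφ : IsIsometricImmersion g φ)
include hφ

lemma isShapeQuadratic_of_soliton {ξ : (p : M) → TangentSpace (𝓡 n) p}
    (hξ : IsTangentialPosition φ ξ) (hsol : IsRicciSoliton g ξ 1) : IsShapeQuadratic φ :=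
  fun _ he _ hP => shapeOp_sq_of_soliton hφ he hP hξ hsol

/-- Around every point there is a chart, and a patch on it. -/
lemma exists_chart_patch (p : M) : ∃ e ∈ charts n M, p ∈ e.source ∧
    ∃ ν, IsPatch e.target (fun u => φ (e.symm u)) ν :=
  ⟨chartAt (Euc n) p, IsManifold.chart_mem_maximalAtlas p, mem_chart_source _ p,
    exists_isPatch_param (IsManifold.chart_mem_maximalAtlas p) hφ⟩

lemma isTotallyUmbilical_of_shapeOp (h : ∀ e ∈ charts n M, ∀ ν,
    IsPatch e.target (fun u => φ (e.symm u)) ν → ∀ u ∈ e.target, ∃ c : ℝ, ∀ v,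
      shapeOp (fun u => φ (e.symm u)) ν u (fderiv ℝ (fun u => φ (e.symm u)) u v)
        = c • fderiv ℝ (fun u => φ (e.symm u)) u v) : IsTotallyUmbilical g φ := by
  intro e he u hu
  obtain ⟨ν, hP⟩ := exists_isPatch_param he hφ
  obtain ⟨c, hc⟩ := h e he ν hP u hu
  refine ⟨c • ν u, Submodule.smul_mem _ _ (normal_mem_orthogonal he hφ.1 hP hu), fun i j => ?_⟩
  have hs : shapeOp (fun u => φ (e.symm u)) ν u (pd i (fun u => φ (e.symm u)) u) =
      c • pd i (fun u => φ (e.symm u)) u := hc _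
  rw [secondFundForm_eq hφ he hP hu, sff, hs, inner_smul_left,
    isInducedMetric_coordMetric he hφ u hu, smul_smul, mul_comm]
  rfl

variable (hq : IsShapeQuadratic φ)

section Chart

variable {e : OpenPartialHomeomorph M (Euc n)} (he : e ∈ charts n M) {ν : Euc n → Euc (n + 1)}
  (hP : IsPatch e.target (fun u => φ (e.symm u)) ν) {u : Euc n} (hu : u ∈ e.target)
include hq he hP hu

lemma finrank_nullity_add {k : ℕ} (hS : shapeOp (fun u => φ (e.symm u)) ν u ≠ 0) :
    Module.finrank ℝ (nullity φ (e.symm u)) + k = n ↔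
      u ∈ multSet (fun u => φ (e.symm u)) ν e.target k := by
  have h := hP.finrank_ker_cylinderProj (hq e he ν hP) hu hS
  rw [← nullity_eq_ker he hφ.1 hP hu (hq e he ν hP) hS] at h
  constructor
  · intro hk
    refine ⟨hu, hS, ?_⟩
    have : (Module.finrank ℝ (nullity φ (e.symm u)) : ℝ) + k = n := by exact_mod_cast hk
    linarith
  · rintro ⟨-, -, hk⟩
    rw [hk] at h
    exact_mod_cast h

lemma finrank_nullity_add_iff {k : ℕ} :
    Module.finrank ℝ (nullity φ (e.symm u)) + k = n ↔
      u ∈ multSet (fun u => φ (e.symm u)) ν e.target k := by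
  by_cases hS : shapeOp (fun u => φ (e.symm u)) ν u = 0
  · constructor
    · intro hk
      rw [(nullity_eq_top_iff he hφ.1 hP hu).2 hS, finrank_top, finrank_euclideanSpace_fin] at hk
      omega
    · rintro ⟨-, hS', -⟩
      exact absurd hS hS'
  · exact finrank_nullity_add hφ hq he hP hu hS

/-- The cylinder projection is determined by the nullity, hence is independent of choices. -/
lemma cylinderProj_eq_starProjection (hS : shapeOp (fun u => φ (e.symm u)) ν u ≠ 0) :
    cylinderProj (fun u => φ (e.symm u)) ν u = (nullity φ (e.symm u))ᗮ.starProjection := by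
  rw [nullity_eq_ker he hφ.1 hP hu (hq e he ν hP) hS]
  ext1 w
  refine (Submodule.eq_starProjection_of_mem_orthogonal ?_ ?_).symm
  · rw [Submodule.mem_orthogonal]
    intro x hx
    have hx' : cylinderProj (fun u => φ (e.symm u)) ν u x = 0 := hx
    rw [← hP.cylinderProj_symm hu, hx', inner_zero_left]
  · apply Submodule.le_orthogonal_orthogonal
    rw [LinearMap.mem_ker]
    change cylinderProj (fun u => φ (e.symm u)) ν u _ = 0
    rw [map_sub, hP.cylinderProj_idem (hq e he ν hP) hu hS, sub_self]

omit hq in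
lemma normalPartSq_eq :
    normalPartSq φ (e.symm u) = support (fun u => φ (e.symm u)) ν u ^ 2 := by
  have h : φ (e.symm u) - tangentProj φ (e.symm u) (φ (e.symm u)) =
      support (fun u => φ (e.symm u)) ν u • ν u := by
    rw [tangentProj_param he hφ.1 hP hu, sub_apply, ContinuousLinearMap.id_apply, sub_sub_cancel,
      normalProj_apply, real_inner_comm]
    rfl
  rw [normalPartSq, h, norm_smul, hP.norm_normal u hu, mul_one, Real.norm_eq_abs, sq_abs]

end Chart

include hq

/-- For `k ≥ 2` the set of points at which the nonzero principal curvature has multiplicity `k` is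
closed, since there `κ² = 1 / (k - 1)` and `tr S = k κ`. -/
lemma isClopen_mult {k : ℕ} (hk : 2 ≤ k) :
    IsClopen {p : M | Module.finrank ℝ (nullity φ p) + k = n} := by
  constructor
  · rw [← isOpen_compl_iff, isOpen_iff_mem_nhds]
    intro p hp
    obtain ⟨e, he, hpe, ν, hP⟩ := exists_chart_patch hφ p
    have hsq := hq e he ν hP
    have hu := e.map_source hpe
    have hce := e.continuousAt hpe
    set ψ : Euc n → Euc (n + 1) := fun u => φ (e.symm u) with hψ
    have hmem : ∀ q ∈ e.source, Module.finrank ℝ (nullity φ q) + k = n ↔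
        e q ∈ multSet ψ ν e.target k := fun q hqe => by
      have := finrank_nullity_add_iff hφ hq he hP (k := k) (e.map_source hqe)
      rwa [e.left_inv hqe] at this
    have hκc : ContinuousAt (fun q => principalCurv ψ ν (e q)) p :=
      ContinuousAt.comp (g := principalCurv ψ ν) (hP.contDiffAt_principalCurv hu).continuousAt hce
    have htc : ContinuousAt (fun q => traceCLM (n + 1) (shapeOp ψ ν (e q))) p :=
      (traceCLM (n + 1)).continuous.continuousAt.comp
        (ContinuousAt.comp (g := shapeOp ψ ν) (hP.contDiffAt_shapeOp hu).continuousAt hce)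
    have hdc : ContinuousAt (fun q => (((k : ℝ) - 1) * principalCurv ψ ν (e q) ^ 2 - 1,
        traceCLM (n + 1) (shapeOp ψ ν (e q)) - k * principalCurv ψ ν (e q))) p :=
      ((continuousAt_const.mul (hκc.pow 2)).sub continuousAt_const).prodMk
        (htc.sub (continuousAt_const.mul hκc))
    by_cases h0 : (((k : ℝ) - 1) * principalCurv ψ ν (e p) ^ 2 - 1,
        traceCLM (n + 1) (shapeOp ψ ν (e p)) - k * principalCurv ψ ν (e p)) = ((0 : ℝ), (0 : ℝ))
    · exfalso
      apply hp
      rw [Prod.mk.injEq] at h0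
      obtain ⟨h1, h2⟩ := h0
      have hκ : principalCurv ψ ν (e p) ≠ 0 := by
        intro h
        rw [h] at h1
        norm_num at h1
      have htr : traceCLM (n + 1) (shapeOp ψ ν (e p)) = k * principalCurv ψ ν (e p) := by linarith
      refine (hmem p hpe).2 ⟨hu, fun hS => ?_, ?_⟩
      · rw [hS, map_zero] at htr
        have hk0 : (k : ℝ) ≠ 0 := by
          have : k ≠ 0 := by omega
          exact_mod_cast this
        exact mul_ne_zero hk0 hκ htr.symm
      · rw [principalProj, map_smul, htr, smul_eq_mul, mul_left_comm, inv_mul_cancel₀ hκ, mul_one]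
    · filter_upwards [hdc.eventually_ne h0, e.open_source.mem_nhds hpe] with q hne hqe hqk
      have hqm := (hmem q hqe).1 hqk
      apply hne
      rw [hP.principalCurv_sq hsq hk hqm, hP.trace_shapeOp_of_mem hsq hqm, sub_self, sub_self]
  · rw [isOpen_iff_mem_nhds]
    intro p hp
    obtain ⟨e, he, hpe, ν, hP⟩ := exists_chart_patch hφ p
    have hmem : ∀ q ∈ e.source, Module.finrank ℝ (nullity φ q) + k = n ↔
        e q ∈ multSet (fun u => φ (e.symm u)) ν e.target k := fun q hqe => by
      have := finrank_nullity_add_iff hφ hq he hP (k := k) (e.map_source hqe)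
      rwa [e.left_inv hqe] at this
    have hnhds := (hP.isOpen_multSet (hq e he ν hP) k).mem_nhds ((hmem p hpe).1 hp)
    filter_upwards [(e.continuousAt hpe).preimage_mem_nhds hnhds, e.open_source.mem_nhds hpe]
      with q hqm hqe using (hmem q hqe).2 hqm

lemma nullity_eq [PreconnectedSpace M] {k : ℕ} (hk : 2 ≤ k)
    (hall : ∀ p : M, Module.finrank ℝ (nullity φ p) + k = n) (p q : M) :
    nullity φ p = nullity φ q := by
  have hloc : IsLocallyConstant (nullity φ) := by
    rw [IsLocallyConstant.iff_eventually_eq]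
    intro p
    obtain ⟨e, he, hpe, ν, hP⟩ := exists_chart_patch hφ p
    have hsq := hq e he ν hP
    have hmem : ∀ u ∈ e.target, u ∈ multSet (fun u => φ (e.symm u)) ν e.target k := fun u hu =>
      (finrank_nullity_add_iff hφ hq he hP hu).1 (hall _)
    have hker : ∀ r ∈ e.source, nullity φ r =
        LinearMap.ker (cylinderProj (fun u => φ (e.symm u)) ν (e r)).toLinearMap := fun r hr => by
      have := nullity_eq_ker he hφ.1 hP (e.map_source hr) hsq (hmem _ (e.map_source hr)).2.1
      rwa [e.left_inv hr] at this
    have hev := hP.cylinderProj_eventually_eq hsq hk (hmem _ (e.map_source hpe))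
    filter_upwards [(e.continuousAt hpe).eventually hev, e.open_source.mem_nhds hpe] with r hr hre
    rw [hker r hre, hker p hpe, hr]
  exact hloc.apply_eq_of_preconnectedSpace p q

lemma isTotallyUmbilical_of_mult_eq
    (hall : ∀ p : M, Module.finrank ℝ (nullity φ p) + n = n) : IsTotallyUmbilical g φ := by
  refine isTotallyUmbilical_of_shapeOp hφ fun e he ν hP u hu => ?_
  have hsq := hq e he ν hP
  obtain ⟨-, hS, -⟩ := (finrank_nullity_add_iff hφ hq he hP hu).1 (hall (e.symm u))
  refine ⟨principalCurv (fun u => φ (e.symm u)) ν u, fun v => ?_⟩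
  have hbot : nullity φ (e.symm u) = ⊥ := by
    rw [← Submodule.finrank_eq_zero (R := ℝ)]
    have := hall (e.symm u)
    omega
  have hR := cylinderProj_eq_starProjection hφ hq he hP hu hS
  simp only [hbot, Submodule.bot_orthogonal_eq_top, Submodule.starProjection_top] at hR
  have h1 := cylinderProj_apply (ψ := fun u => φ (e.symm u)) (ν := ν) u
    (fderiv ℝ (fun u => φ (e.symm u)) u v)
  rw [hR, real_inner_comm, hP.normal u hu, zero_smul, add_zero] at h1
  rw [hP.shapeOp_eq_smul hsq hu hS, smul_apply, ← h1]
  rfl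

lemma range_eq_of_mult [PreconnectedSpace M] [Nonempty M] {k : ℕ} (hk : 2 ≤ k)
    (hall : ∀ p : M, Module.finrank ℝ (nullity φ p) + k = n) :
    ∃ T : Euc (n + 1) ≃ₗᵢ[ℝ] Euc (n + 1), ∃ O : Set (Euc (n + 1)),
      IsOpen O ∧ Set.range φ = O ∩ T '' sphericalHypercylinder n k := by
  obtain ⟨p₀⟩ := ‹Nonempty M›
  have hW : Module.finrank ℝ (nullity φ p₀)ᗮ = k + 1 := by
    have h1 := (nullity φ p₀).finrank_add_finrank_orthogonal
    rw [finrank_euclideanSpace_fin] at h1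
    have h2 := hall p₀
    omega
  obtain ⟨T, hT⟩ := exists_isometry_cylinder (n := n) (k := k) _ hW
  set R := (nullity φ p₀)ᗮ.starProjection with hRdef
  have hk1 : (0 : ℝ) < (k : ℝ) - 1 := by
    have : (2 : ℝ) ≤ k := by exact_mod_cast hk
    linarith
  have hloc : ∀ e ∈ charts n M, ∀ ν, IsPatch e.target (fun u => φ (e.symm u)) ν →
      ∀ u ∈ e.target, u ∈ multSet (fun u => φ (e.symm u)) ν e.target k ∧
        cylinderProj (fun u => φ (e.symm u)) ν u = R := fun e he ν hP u hu => by
    have hmem := (finrank_nullity_add_iff hφ hq he hP hu).1 (hall (e.symm u))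
    refine ⟨hmem, ?_⟩
    rw [cylinderProj_eq_starProjection hφ hq he hP hu hmem.2.1]
    simp only [nullity_eq hφ hq hk hall (e.symm u) p₀]
    rfl
  have hcyl : ∀ e ∈ charts n M, ∀ ν, IsPatch e.target (fun u => φ (e.symm u)) ν →
      ∀ u ∈ e.target, ‖R (φ (e.symm u))‖ ^ 2 = (k : ℝ) - 1 := fun e he ν hP u hu => by
    obtain ⟨h1, h2⟩ := hloc e he ν hP u hu
    have := hP.norm_cylinderProj_sq (hq e he ν hP) hk h1
    rwa [h2] at this
  refine ⟨T, interior {y | ‖R y‖ ^ 2 = (k : ℝ) - 1 → y ∈ Set.range φ}, isOpen_interior, ?_⟩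
  rw [hT]
  refine Set.Subset.antisymm ?_ fun y hy => interior_subset hy.1 hy.2
  rintro _ ⟨p, rfl⟩
  obtain ⟨e, he, hpe, ν, hP⟩ := exists_chart_patch hφ p
  have hu := e.map_source hpe
  obtain ⟨h1, h2⟩ := hloc e he ν hP _ hu
  constructor
  · rw [mem_interior_iff_mem_nhds]
    have hev := hP.eventually_mem_image_of_cylinder (R := R) (fun w => ?_) hk1
      (hcyl e he ν hP) hu ?_
    · simp only [e.left_inv hpe] at hev
      filter_upwards [hev] with y hy hyR
      obtain ⟨u, -, rfl⟩ := hy hyR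
      exact Set.mem_range_self _
    · rw [← h2, hP.cylinderProj_idem (hq e he ν hP) hu h1.2.1]
    · rw [← h2, cylinderProj_apply, hP.principalProj_position (hq e he ν hP) hk h1, zero_add,
        real_inner_comm]
      rfl
  · have := hcyl e he ν hP _ hu
    rwa [e.left_inv hpe] at this

/-- If the shape operator has rank at most one everywhere, then `ρ²` is constant: `ρ = 0` where the
rank is one, and `dρ = 0` where the shape operator vanishes. -/
lemma normalPartSq_eq_of_rank_le_one [PreconnectedSpace M]
    (hall : ∀ p : M, nullity φ p = ⊤ ∨ Module.finrank ℝ (nullity φ p) + 1 = n) (p q : M) :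
    normalPartSq φ p = normalPartSq φ q := by
  have hloc : IsLocallyConstant (normalPartSq φ) := by
    rw [IsLocallyConstant.iff_eventually_eq]
    intro p
    obtain ⟨e, he, hpe, ν, hP⟩ := exists_chart_patch hφ p
    set ψ : Euc n → Euc (n + 1) := fun u => φ (e.symm u) with hψ
    have hd : ∀ u ∈ e.target, DifferentiableAt ℝ (support ψ ν) u := fun u hu =>
      (hP.contDiffAt_support hu).differentiableAt (by simp)
    have hzero : ∀ u ∈ e.target, fderiv ℝ (fun u => support ψ ν u ^ 2) u = 0 := by
      intro u hu
      rw [fderiv_fun_pow 2 (hd u hu)]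
      rcases hall (e.symm u) with h | h
      · have hS := (nullity_eq_top_iff he hφ.1 hP hu).1 h
        have : fderiv ℝ (support ψ ν) u = 0 := by
          ext1 v
          rw [hP.fderiv_support hu, hS]
          simp
        rw [this, smul_zero]
      · have hm := (finrank_nullity_add_iff hφ hq he hP hu).1 h
        rw [hP.support_eq_of_mem (hq e he ν hP) hm]
        simp
    obtain ⟨r, hr, hball⟩ := Metric.isOpen_iff.1 e.open_target _ (e.map_source hpe)
    filter_upwards [(e.continuousAt hpe).preimage_mem_nhds (Metric.ball_mem_nhds _ hr),
      e.open_source.mem_nhds hpe] with q hq' hqe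
    have h1 := normalPartSq_eq hφ he hP (e.map_source hqe)
    have h2 := normalPartSq_eq hφ he hP (e.map_source hpe)
    rw [e.left_inv hqe] at h1
    rw [e.left_inv hpe] at h2
    rw [h1, h2]
    exact Metric.isOpen_ball.is_const_of_fderiv_eq_zero (𝕜 := ℝ) (f := fun u => support ψ ν u ^ 2)
      (convex_ball _ r).isPreconnected
      (fun x hx => ((hd x (hball hx)).pow 2).differentiableWithinAt)
      (fun x hx => hzero x (hball hx)) hq' (Metric.mem_ball_self hr)
  exact hloc.apply_eq_of_preconnectedSpace p q

lemma isFlat_of_rank_le_one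
    (hall : ∀ p : M, nullity φ p = ⊤ ∨ Module.finrank ℝ (nullity φ p) + 1 = n) : IsFlat g := by
  intro e he u hu i j k l
  obtain ⟨ν, hP⟩ := exists_isPatch_param he hφ
  rw [hP.gauss (isInducedMetric_coordMetric he hφ) hu]
  rcases hall (e.symm u) with h | h
  · have hS := (nullity_eq_top_iff he hφ.1 hP hu).1 h
    simp [sff, hS]
  · -- the image of `S` is spanned by a single vector `q`
    obtain ⟨-, hS, htr⟩ := (finrank_nullity_add_iff hφ hq he hP hu).1 h
    rw [hP.trace_principalProj (hq e he ν hP) hu hS] at htr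
    have hone : Module.finrank ℝ (LinearMap.range
        (principalProj (fun u => φ (e.symm u)) ν u).toLinearMap) = 1 := by exact_mod_cast htr
    obtain ⟨⟨q, _⟩, -, hq1⟩ := finrank_eq_one_iff'.1 hone
    have hspan : ∀ w, ∃ c : ℝ, shapeOp (fun u => φ (e.symm u)) ν u w = c • q := by
      intro w
      obtain ⟨c, hc⟩ := hq1 ⟨principalProj (fun u => φ (e.symm u)) ν u w, ⟨w, rfl⟩⟩
      have hc' : c • q = principalProj (fun u => φ (e.symm u)) ν u w := congrArg Subtype.val hc
      exact ⟨principalCurv (fun u => φ (e.symm u)) ν u * c, by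
        rw [hP.shapeOp_eq_smul (hq e he ν hP) hu hS, smul_apply, ← hc', smul_smul]⟩
    obtain ⟨a, ha⟩ := hspan (pd i (fun u => φ (e.symm u)) u)
    obtain ⟨b, hb⟩ := hspan (pd j (fun u => φ (e.symm u)) u)
    rw [sff, sff, ha, hb, inner_smul_left, inner_smul_left, map_smul, map_smul]
    simp
    ring

omit hq in
lemma isRuled_of_normalPartSq_eq_zero (hn : 0 < n) (h0 : ∀ p : M, normalPartSq φ p = 0) :
    IsRuledByLinesThroughOrigin φ := by
  intro p
  obtain ⟨e, he, hpe, ν, hP⟩ := exists_chart_patch hφ p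
  obtain ⟨v, hv, hpv, ε, hε, γ, hγ, hγ0, hγt⟩ := hP.exists_segment hn (fun u hu => by
    have := normalPartSq_eq hφ he hP hu
    rw [h0] at this
    exact pow_eq_zero_iff (two_ne_zero) |>.1 this.symm) (e.map_source hpe)
  simp only [e.left_inv hpe] at hpv hγt
  refine ⟨v, hv, hpv, ε, hε, fun t => e.symm (γ t), ?_, ?_, fun t ht => (hγt t ht).2⟩
  · exact e.continuousOn_symm.comp hγ fun t ht => (hγt t ht).1
  · simp only [hγ0, e.left_inv hpe]

lemma finrank_nullity_add_one_or_eq_top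
    (hne : ∀ k, 2 ≤ k → ∀ p : M, Module.finrank ℝ (nullity φ p) + k ≠ n) (p : M) :
    nullity φ p = ⊤ ∨ Module.finrank ℝ (nullity φ p) + 1 = n := by
  rw [or_iff_not_imp_left]
  intro htop
  obtain ⟨e, he, hpe, ν, hP⟩ := exists_chart_patch hφ p
  have hu := e.map_source hpe
  have h1 := nullity_eq_top_iff he hφ.1 hP hu
  rw [e.left_inv hpe] at h1
  have hS := fun h => htop (h1.2 h)
  have htr := hP.trace_principalProj (hq e he ν hP) hu hS
  have hr := (finrank_nullity_add_iff hφ hq he hP hu).2 ⟨hu, hS, htr⟩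
  rw [e.left_inv hpe] at hr
  -- a projection of rank zero vanishes
  have hpos : Module.finrank ℝ (LinearMap.range
      (principalProj (fun u => φ (e.symm u)) ν (e p)).toLinearMap) ≠ 0 := by
    intro h0
    apply hS
    rw [Submodule.finrank_eq_zero, LinearMap.range_eq_bot] at h0
    rw [hP.shapeOp_eq_smul (hq e he ν hP) hu hS]
    ext1 w
    have : principalProj (fun u => φ (e.symm u)) ν (e p) w = 0 :=
      congrArg (fun L : Euc (n + 1) →ₗ[ℝ] Euc (n + 1) => L w) h0
    simp [this]
  by_contra h
  refine hne _ ?_ p hr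
  have : Module.finrank ℝ (LinearMap.range
      (principalProj (fun u => φ (e.symm u)) ν (e p)).toLinearMap) ≠ 1 := fun h1 =>
    h (by rw [h1] at hr; exact hr)
  omega

end Global

end RicciSoliton

end

open RicciSoliton in
theorem theorem6p1 (n : ℕ) (M : Type*) [TopologicalSpace M] [T2Space M]
    [SecondCountableTopology M] [ConnectedSpace M] [ChartedSpace (Euc n) M]
    [IsManifold (𝓡 n) ∞ M]
    (g : RicciSoliton.Metric n M) (φ : M → Euc (n + 1)) (hφ : IsIsometricImmersion g φ)
    (ξ : (p : M) → TangentSpace (𝓡 n) p) (hξ : IsTangentialPosition φ ξ)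
    (hsol : IsRicciSoliton g ξ 1) :
    IsTotallyUmbilical g φ ∨
    (IsFlat g ∧ IsRuledByLinesThroughOrigin φ) ∨
    (∃ k : ℕ, 2 ≤ k ∧ k + 1 ≤ n ∧ ∃ T : Euc (n + 1) ≃ₗᵢ[ℝ] Euc (n + 1), ∃ O : Set (Euc (n + 1)),
      IsOpen O ∧ Set.range φ = O ∩ T '' sphericalHypercylinder n k) := by
  have hq := isShapeQuadratic_of_soliton hφ hξ hsol
  by_cases hex : ∃ k, 2 ≤ k ∧ ∃ p : M, Module.finrank ℝ (nullity φ p) + k = n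
  · obtain ⟨k, hk, p, hp⟩ := hex
    have huniv := (isClopen_mult hφ hq hk).eq_univ ⟨p, hp⟩
    have hall : ∀ q : M, Module.finrank ℝ (nullity φ q) + k = n := fun q => by
      have : q ∈ {p : M | Module.finrank ℝ (nullity φ p) + k = n} := by rw [huniv]; trivial
      exact this
    rcases (show k ≤ n by omega).eq_or_lt with rfl | hlt
    · exact Or.inl (isTotallyUmbilical_of_mult_eq hφ hq hall)
    · exact Or.inr (Or.inr ⟨k, hk, hlt, range_eq_of_mult hφ hq hk hall⟩)
  · push Not at hex
    have hall := finrank_nullity_add_one_or_eq_top hφ hq hex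
    by_cases htop : ∀ p : M, nullity φ p = ⊤
    · refine Or.inl (isTotallyUmbilical_of_shapeOp hφ fun e he ν hP u hu => ⟨0, fun v => ?_⟩)
      rw [(nullity_eq_top_iff he hφ.1 hP hu).1 (htop _), zero_smul]
      rfl
    · push Not at htop
      obtain ⟨p, hp⟩ := htop
      have hp1 := (hall p).resolve_left hp
      refine Or.inr (Or.inl ⟨isFlat_of_rank_le_one hφ hq hall,
        isRuled_of_normalPartSq_eq_zero hφ (by omega) fun q => ?_⟩)
      rw [normalPartSq_eq_of_rank_le_one hφ hq hall q p]
      obtain ⟨e, he, hpe, ν, hP⟩ := exists_chart_patch hφ p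
      have hu := e.map_source hpe
      have h1 := normalPartSq_eq hφ he hP hu
      have h2 := finrank_nullity_add_iff hφ hq he hP hu (k := 1)
      rw [e.left_inv hpe] at h1 h2
      rw [h1, hP.support_eq_of_mem (hq e he ν hP) (h2.1 hp1)]
      simp
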